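/- Let $(\mathcal{A},\mathbb{E},\mathcal{B})$ be an operator-valued $C^\ast$-probability space: $\mathcal{A}$ is a unital $C^\ast$-algebra, $\mathcal{B}$ is a $C^\ast$-subalgebra of $\mathcal{A}$ containing its unit $\mathbf 1$, and $\mathbb{E}:\mathcal{A}\to\mathcal{B}$ is a conditional expectation, i.e. a positive linear map with $\mathbb{E}[b]=b$ and $\mathbb{E}[b_1xb_2]=b_1\mathbb{E}[x]b_2$ for all $b,b_1,b_2\in\mathcal{B}$ and $x\in\mathcal{A}$. Let $\phi$ be a state on $\mathcal{B}$ (a continuous positive linear functional with $\|\phi\|=1$), and let $\eta:\mathcal{B}\to\mathcal{B}$ be a completely positive linear map. Let $s\in\mathcal{A}$ be a (not necessarily centered) $\mathcal{B}$-valued semicircular element with covariance $\eta$. This means that $s=s^\ast$ and that $s^\circ:=s-\mathbb{E}[s]$ satisfies $$\mathbb{E}[s^\circ b_1 s^\circ b_2\cdots s^\circ b_{k-1}s^\circ]=\sum_{\pi\in NC_2(k)}\eta_\pi(b_1,\dots,b_{k-1})\qquad\text{for all } k\ge 1,\ b_1,\dots,b_{k-1}\in\mathcal{B},$$ where $NC_2(k)$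 is the set of non-crossing pairings of $\{1,\dots,k\}$ and $\eta_\pi$ is given by applying $\eta$ to its arguments according to the nested block structure of $\pi$ (for example, $\eta_{\{\{1,4\},\{2,3\}\}}(b_1,b_2,b_3)=\eta(b_1\eta(b_2)b_3)$ and $\eta_{\{\{1,2\},\{3,4\}\}}(b_1,b_2,b_3)=\eta(b_1)b_2\eta(b_3)$). Let $\mu_s$ be the analytic distribution of $s$ with respect to the state $\phi\circ\mathbb{E}$ on $\mathcal{A}$, i.e. the unique Borel probability measure on $\mathbb{R}$ with $\int_{\mathbb R} t^k\,d\mu_s(t)=\phi(\mathbb{E}[s^k])$ for all $k\ge 0$. For $y>0$ put $\theta_{\mu_s}(y):=-y\,\Im\big(G_{\mu_s}(iy)\big)$, where $G_{\mu_s}(z)=\int_{\mathbb R}\frac{1}{z-t}\,d\mu_s(t)$. Let $\mathbb{H}^-(\mathcal{B}):=\{w\in\mathcal{B}\mid \exists\,\delta>0:\ -\Im(w)\ge\delta\mathbf 1\}$ with $\Im(w)=\frac{1}{2i}(w-w^\ast)$, and put $\Delta_b(w):=b-w^{-1}-\eta(w)$ for $w\in\mathbb{H}^-(\mathcal{B})$.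 Then, for all $y>0$ and $\epsilon>0$ and every $\tilde w\in\mathbb{H}^-(\mathcal{B})$ with $\|\Delta_b(\tilde w)\|<\frac{y\epsilon}{1+\epsilon}$ at the point $b=iy\mathbf 1-\mathbb{E}[s]$, the number $\tilde\theta:=-y\,\Im(\phi(\tilde w))$ satisfies $$|\theta_{\mu_s}(y)-\tilde\theta|<\epsilon\sqrt{\theta_{\mu_s}(y)}\le\epsilon.$$ -/

import Mathlib

open scoped ComplexOrder ComplexStarModule CStarAlgebra CompactlySupported
open MeasureTheory

namespace FreeProb

universe u v

/-! ### States and `C*`-probability spaces -/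

/-- A state on a unital `C*`-algebra: a continuous positive linear functional of norm one.
A `C*`-probability space is a unital `C*`-algebra together with a state. -/
structure CStarState (A : Type u) [CStarAlgebra A] where
  /-- the underlying continuous linear functional -/
  toCLM : A →L[ℂ] ℂ
  map_star_mul_self_nonneg : ∀ x : A, 0 ≤ toCLM (star x * x)
  norm_eq_one : ‖toCLM‖ = 1

namespace CStarState

variable {A : Type u} [CStarAlgebra A]

noncomputable instance : CoeFun (CStarState A) (fun _ => A → ℂ) := ⟨fun φ => φ.toCLM⟩

end CStarState

section PositiveFunctional

variable {A : Type u} [CStarAlgebra A] [PartialOrder A] [StarOrderedRing A]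

theorem norm_apply_sq_le (f : A →ₚ[ℂ] ℂ) (x : A) :
    ‖f x‖ ^ 2 ≤ (f 1).re * (f (star x * x)).re := by
  have h := norm_inner_le_norm (𝕜 := ℂ) (f.toPreGNS 1) (f.toPreGNS x)
  rw [f.preGNS_inner_def, f.preGNS_norm_def, f.preGNS_norm_def] at h
  simp only [PositiveLinearMap.ofPreGNS_toPreGNS, star_one, one_mul] at h
  have h1 : 0 ≤ (f 1).re := (Complex.nonneg_iff.mp (f.map_nonneg zero_le_one)).1
  have h2 : 0 ≤ (f (star x * x)).re :=
    (Complex.nonneg_iff.mp (f.map_nonneg (star_mul_self_nonneg x))).1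
  calc ‖f x‖ ^ 2 ≤ (√(f 1).re * √(f (star x * x)).re) ^ 2 := by gcongr
    _ = _ := by rw [mul_pow, Real.sq_sqrt h1, Real.sq_sqrt h2]

theorem norm_apply_le (f : A →ₚ[ℂ] ℂ) (x : A) : ‖f x‖ ≤ (f 1).re * ‖x‖ := by
  have h1 : 0 ≤ (f 1).re := (Complex.nonneg_iff.mp (f.map_nonneg zero_le_one)).1
  have h2 : (f (star x * x)).re ≤ (f 1).re * ‖x‖ ^ 2 := by
    have := OrderHomClass.mono f
      (IsSelfAdjoint.le_algebraMap_norm_self (IsSelfAdjoint.star_mul_self x))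
    have h3 : f (algebraMap ℝ A ‖star x * x‖) = (‖star x * x‖ : ℂ) * f 1 := by
      rw [Algebra.algebraMap_eq_smul_one, ← Complex.coe_smul, map_smul, smul_eq_mul]
    rw [h3] at this
    have := (Complex.le_def.mp this).1
    rw [Complex.re_ofReal_mul, CStarRing.norm_star_mul_self] at this
    nlinarith
  refine le_of_sq_le_sq ?_ (by positivity)
  calc ‖f x‖ ^ 2 ≤ (f 1).re * (f (star x * x)).re := norm_apply_sq_le f x
    _ ≤ (f 1).re * ((f 1).re * ‖x‖ ^ 2) := by gcongr
    _ = _ := by ring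

end PositiveFunctional

namespace CStarState

variable {A : Type u} [CStarAlgebra A] [PartialOrder A] [StarOrderedRing A]

theorem map_nonneg (φ : CStarState A) {x : A} (hx : 0 ≤ x) : 0 ≤ φ x := by
  obtain ⟨y, rfl⟩ := CStarAlgebra.nonneg_iff_eq_star_mul_self.mp hx
  exact φ.map_star_mul_self_nonneg y

/-- A state as a positive linear map. -/
noncomputable def toPositive (φ : CStarState A) : A →ₚ[ℂ] ℂ :=
  .mk₀ (φ.toCLM : A →ₗ[ℂ] ℂ) fun _ hx => φ.map_nonneg hx

theorem map_one (φ : CStarState A) : φ 1 = 1 := by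
  have h0 : 0 ≤ φ 1 := φ.map_nonneg zero_le_one
  obtain ⟨hre, him⟩ := Complex.nonneg_iff.mp h0
  have h1 : 1 ≤ (φ 1).re := by
    rw [← φ.norm_eq_one]
    exact φ.toCLM.opNorm_le_bound hre fun x => norm_apply_le φ.toPositive x
  have h2 : (φ 1).re ≤ 1 := by
    have h3 : ‖(1 : A)‖ ≤ 1 := by
      rcases subsingleton_or_nontrivial A with _ | _
      · simp [Subsingleton.elim (1 : A) 0]
      · simp
    calc (φ 1).re ≤ ‖φ 1‖ := Complex.re_le_norm _
      _ ≤ ‖φ.toCLM‖ * ‖(1 : A)‖ := φ.toCLM.le_opNorm 1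
      _ ≤ 1 := by rw [φ.norm_eq_one, one_mul]; exact h3
  exact Complex.ext (le_antisymm h2 h1) him.symm

/-- A unital positive linear functional is a state. -/
noncomputable def ofPositive (f : A →ₚ[ℂ] ℂ) (h1 : f 1 = 1) : CStarState A where
  toCLM := LinearMap.mkContinuous (f : A →ₗ[ℂ] ℂ) 1 fun x => by
    simpa [h1] using norm_apply_le f x
  map_star_mul_self_nonneg x := f.map_nonneg (star_mul_self_nonneg x)
  norm_eq_one := by
    refine le_antisymm (LinearMap.mkContinuous_norm_le _ zero_le_one _) ?_
    have : Nontrivial A := by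
      by_contra h
      rw [not_nontrivial_iff_subsingleton] at h
      have : (1 : A) = 0 := Subsingleton.elim _ _
      rw [this, _root_.map_zero] at h1
      exact zero_ne_one h1
    have := ContinuousLinearMap.le_opNorm (LinearMap.mkContinuous (f : A →ₗ[ℂ] ℂ) 1
      fun x => by simpa [h1] using norm_apply_le f x) 1
    simpa [h1] using this

@[simp] theorem ofPositive_apply (f : A →ₚ[ℂ] ℂ) (h1 : f 1 = 1) (x : A) :
    ofPositive f h1 x = f x := rfl

end CStarState

/-! ### The analytic distribution of a selfadjoint element -/

section AnalyticDistribution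

variable {A : Type u} [CStarAlgebra A] [PartialOrder A] [StarOrderedRing A]

/-- The positive functional `f ↦ φ(f(x))` on the continuous functions on the spectrum of `x`. -/
noncomputable def spectralFunctional (φ : CStarState A) (x : A) (hx : IsSelfAdjoint x) :
    C_c(spectrum ℝ x, ℝ) →ₚ[ℝ] ℝ :=
  .mk₀
    { toFun := fun f => (φ (cfcHom (R := ℝ) hx (f : C(spectrum ℝ x, ℝ)))).re
      map_add' := fun f g => by
        have : ((f + g : C_c(spectrum ℝ x, ℝ)) : C(spectrum ℝ x, ℝ)) = f + g := rfl
        simp [this]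
      map_smul' := fun c f => by
        have : ((c • f : C_c(spectrum ℝ x, ℝ)) : C(spectrum ℝ x, ℝ))
          = c • (f : C(spectrum ℝ x, ℝ)) := rfl
        rw [this, map_smul, ← Complex.coe_smul, map_smul]
        simp }
    (fun f hf => (Complex.nonneg_iff.mp (φ.map_nonneg
      ((cfcHom_nonneg_iff (R := ℝ) hx).mpr (show (0 : C(spectrum ℝ x, ℝ)) ≤ f from hf)))).1)

/-- The analytic distribution of the selfadjoint noncommutative random variable `x` in the
`C*`-probability space `(A, φ)`: the Borel measure on the real line which represents the functional
`f ↦ φ(f(x))`. By the three theorems below it is the unique Borel probability measure on `ℝ`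
with moments `φ(x ^ k)`. -/
noncomputable def analyticDistribution (φ : CStarState A) (x : A) (hx : IsSelfAdjoint x) :
    Measure ℝ :=
  (RealRMK.rieszMeasure (spectralFunctional φ x hx)).map Subtype.val

theorem integral_rieszMeasure_spectralFunctional (φ : CStarState A) (x : A)
    (hx : IsSelfAdjoint x) (f : C(spectrum ℝ x, ℝ)) :
    ∫ t, f t ∂(RealRMK.rieszMeasure (spectralFunctional φ x hx))
      = (φ (cfcHom (R := ℝ) hx f)).re :=
  RealRMK.integral_rieszMeasure (spectralFunctional φ x hx)
    (CompactlySupportedContinuousMap.continuousMapEquiv f)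

instance isProbabilityMeasure_analyticDistribution (φ : CStarState A) (x : A)
    (hx : IsSelfAdjoint x) : IsProbabilityMeasure (analyticDistribution φ x hx) := by
  have : IsProbabilityMeasure (RealRMK.rieszMeasure (spectralFunctional φ x hx)) := by
    have h := integral_rieszMeasure_spectralFunctional φ x hx 1
    simp only [ContinuousMap.one_apply, integral_const, smul_eq_mul, mul_one, _root_.map_one,
      φ.map_one, Complex.one_re] at h
    rw [Measure.real] at h
    exact ⟨(ENNReal.toReal_eq_one_iff _).mp h⟩
  exact Measure.isProbabilityMeasure_map measurable_subtype_coe.aemeasurable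

theorem analyticDistribution_integrable_pow (φ : CStarState A) (x : A) (hx : IsSelfAdjoint x)
    (k : ℕ) : Integrable (fun t : ℝ => t ^ k) (analyticDistribution φ x hx) := by
  have hS : MeasurableSet (spectrum ℝ x) := (spectrum.isCompact x).measurableSet
  have := isProbabilityMeasure_analyticDistribution φ x hx
  obtain ⟨C, hC⟩ := ((spectrum.isCompact (𝕜 := ℝ) x).image
    (continuous_pow k)).isBounded.exists_norm_le
  refine Integrable.of_bound (C := C) (by fun_prop) ?_
  refine (MeasurableEmbedding.subtype_coe hS).ae_map_iff.mpr (Filter.Eventually.of_forall ?_)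
  intro t
  exact hC _ ⟨t, t.2, rfl⟩

theorem analyticDistribution_moment (φ : CStarState A) (x : A) (hx : IsSelfAdjoint x) (k : ℕ) :
    ((∫ t, t ^ k ∂(analyticDistribution φ x hx) : ℝ) : ℂ) = φ (x ^ k) := by
  have hS : MeasurableSet (spectrum ℝ x) := (spectrum.isCompact x).measurableSet
  have h := integral_rieszMeasure_spectralFunctional φ x hx
    (((ContinuousMap.id ℝ).restrict (spectrum ℝ x)) ^ k)
  rw [map_pow, cfcHom_id] at h
  rw [analyticDistribution, (MeasurableEmbedding.subtype_coe hS).integral_map]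
  have h2 : (φ (x ^ k)).im = 0 := by
    have h3 : IsSelfAdjoint (φ.toPositive (x ^ k)) := (hx.pow k).map φ.toPositive
    exact Complex.conj_eq_iff_im.mp h3
  exact Complex.ext (by simpa using h) (by simpa using h2.symm)

/-- A probability measure with moments bounded by `R ^ k` is concentrated on `[-R, R]`. -/
theorem ae_abs_le_of_moment_le {μ : Measure ℝ} [IsProbabilityMeasure μ] {R : ℝ} (hR : 0 ≤ R)
    (hint : ∀ k : ℕ, Integrable (fun t : ℝ => t ^ k) μ)
    (hmom : ∀ k : ℕ, ∫ t, t ^ k ∂μ ≤ R ^ k) : ∀ᵐ t ∂μ, |t| ≤ R := by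
  have key : ∀ r : ℝ, R < r → μ {t | r ≤ |t|} = 0 := by
    intro r hr
    have hr0 : 0 < r := hR.trans_lt hr
    have hle : ∀ k : ℕ, μ.real {t | r ≤ |t|} ≤ ((R / r) ^ 2) ^ k := by
      intro k
      have h1 := mul_meas_ge_le_integral_of_nonneg (μ := μ) (f := fun t : ℝ => t ^ (2 * k))
        (Filter.Eventually.of_forall fun t => by simpa [pow_mul] using pow_nonneg (sq_nonneg t) k)
        (hint (2 * k)) (r ^ (2 * k))
      have h2 : {t : ℝ | r ≤ |t|} ⊆ {t : ℝ | r ^ (2 * k) ≤ t ^ (2 * k)} := by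
        intro t ht
        have : t ^ (2 * k) = |t| ^ (2 * k) := by rw [pow_mul, pow_mul, sq_abs]
        simp only [Set.mem_ofPred_eq] at ht ⊢
        rw [this]
        gcongr
      have h3 := measureReal_mono (μ := μ) h2
      have h4 : r ^ (2 * k) * μ.real {t | r ≤ |t|} ≤ R ^ (2 * k) :=
        (mul_le_mul_of_nonneg_left h3 (by positivity)).trans (h1.trans (hmom _))
      rw [← pow_mul, div_pow, le_div_iff₀ (by positivity), mul_comm]
      exact h4
    have hq : (R / r) ^ 2 < 1 := by
      have : R / r < 1 := (div_lt_one hr0).mpr hr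
      have h0 : 0 ≤ R / r := by positivity
      nlinarith
    have h5 : μ.real {t | r ≤ |t|} ≤ 0 :=
      ge_of_tendsto' (tendsto_pow_atTop_nhds_zero_of_lt_one (sq_nonneg _) hq) hle
    exact (measureReal_eq_zero_iff).mp (le_antisymm h5 measureReal_nonneg)
  have h : ∀ n : ℕ, ∀ᵐ t ∂μ, |t| < R + 1 / ((n : ℝ) + 1) := by
    intro n
    rw [ae_iff]
    simpa only [not_lt] using key (R + 1 / ((n : ℝ) + 1)) (by
      have : (0 : ℝ) < 1 / ((n : ℝ) + 1) := by positivity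
      linarith)
  filter_upwards [ae_all_iff.mpr h] with t ht
  have hlim : Filter.Tendsto (fun n : ℕ => R + 1 / ((n : ℝ) + 1)) Filter.atTop (nhds (R + 0)) :=
    tendsto_one_div_add_atTop_nhds_zero_nat.const_add R
  rw [add_zero] at hlim
  exact ge_of_tendsto' hlim fun n => (ht n).le

theorem integral_polynomial_eq {μ ν : Measure ℝ}
    (hμ : ∀ k : ℕ, Integrable (fun t : ℝ => t ^ k) μ)
    (hν : ∀ k : ℕ, Integrable (fun t : ℝ => t ^ k) ν)
    (h : ∀ k : ℕ, ∫ t, t ^ k ∂μ = ∫ t, t ^ k ∂ν) (p : Polynomial ℝ) :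
    Integrable (fun t => p.eval t) μ ∧ Integrable (fun t => p.eval t) ν ∧
      ∫ t, p.eval t ∂μ = ∫ t, p.eval t ∂ν := by
  simp only [Polynomial.eval_eq_sum_range]
  refine ⟨integrable_finsetSum _ fun k _ => (hμ k).const_mul _,
    integrable_finsetSum _ fun k _ => (hν k).const_mul _, ?_⟩
  rw [integral_finsetSum _ fun k _ => (hμ k).const_mul _,
    integral_finsetSum _ fun k _ => (hν k).const_mul _]
  simp only [integral_const_mul, h]

theorem abs_integral_sub_le {μ : Measure ℝ} [IsProbabilityMeasure μ] {f g : ℝ → ℝ} {ε : ℝ}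
    (hf : Integrable f μ) (hg : Integrable g μ) (h : ∀ᵐ t ∂μ, |f t - g t| ≤ ε) :
    |∫ t, f t ∂μ - ∫ t, g t ∂μ| ≤ ε := by
  rw [← integral_sub hf hg]
  simpa using norm_integral_le_of_norm_le_const (μ := μ) (f := fun t => f t - g t) (C := ε)
    (by simpa using h)

theorem analyticDistribution_unique (φ : CStarState A) (x : A) (hx : IsSelfAdjoint x)
    (μ : Measure ℝ) [IsProbabilityMeasure μ] (hint : ∀ k : ℕ, Integrable (fun t : ℝ => t ^ k) μ)
    (hmom : ∀ k : ℕ, ((∫ t, t ^ k ∂μ : ℝ) : ℂ) = φ (x ^ k)) :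
    μ = analyticDistribution φ x hx := by
  set ν := analyticDistribution φ x hx with hν
  have hintν := analyticDistribution_integrable_pow φ x hx
  have hmomν := analyticDistribution_moment φ x hx
  have heq : ∀ k : ℕ, ∫ t, t ^ k ∂μ = ∫ t, t ^ k ∂ν := fun k => by
    exact_mod_cast (hmom k).trans (hmomν k).symm
  have hbound : ∀ k : ℕ, ∫ t, t ^ k ∂μ ≤ ‖x‖ ^ k := by
    intro k
    have h1 : ‖(1 : A)‖ ≤ 1 := by
      rcases subsingleton_or_nontrivial A with _ | _
      · simp [Subsingleton.elim (1 : A) 0]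
      · simp
    have h2 : ‖x ^ k‖ ≤ ‖x‖ ^ k := by
      rcases Nat.eq_zero_or_pos k with rfl | hk
      · simpa using h1
      · exact norm_pow_le' x hk
    calc ∫ t, t ^ k ∂μ ≤ ‖((∫ t, t ^ k ∂μ : ℝ) : ℂ)‖ := by
          rw [Complex.norm_real]; exact le_abs_self _
      _ = ‖φ (x ^ k)‖ := by rw [hmom]
      _ ≤ ‖φ.toCLM‖ * ‖x ^ k‖ := φ.toCLM.le_opNorm _
      _ ≤ ‖x‖ ^ k := by rw [φ.norm_eq_one, one_mul]; exact h2
  have haeμ := ae_abs_le_of_moment_le (norm_nonneg x) hint hbound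
  have haeν := ae_abs_le_of_moment_le (norm_nonneg x) hintν fun k => (heq k) ▸ hbound k
  refine ext_of_forall_integral_eq_of_IsFiniteMeasure fun f => ?_
  refine eq_of_forall_dist_le fun ε hε => ?_
  obtain ⟨p, hp⟩ := exists_polynomial_near_of_continuousOn (-‖x‖) ‖x‖ f
    f.continuous.continuousOn (ε / 2) (half_pos hε)
  obtain ⟨hpμ, hpν, hpeq⟩ := integral_polynomial_eq hint hintν heq p
  have h1 := abs_integral_sub_le (f.integrable μ) hpμ (ε := ε / 2) (by
    filter_upwards [haeμ] with t ht
    rw [abs_sub_comm]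
    exact (hp t (abs_le.mp ht)).le)
  have h2 := abs_integral_sub_le (f.integrable ν) hpν (ε := ε / 2) (by
    filter_upwards [haeν] with t ht
    rw [abs_sub_comm]
    exact (hp t (abs_le.mp ht)).le)
  rw [Real.dist_eq]
  rw [abs_le] at *
  constructor <;> linarith [h1.1, h1.2, h2.1, h2.2]

end AnalyticDistribution

/-- The Cauchy transform `z ↦ ∫ 1 / (z - t) dμ(t)` of a finite Borel measure on the real line. -/
noncomputable def cauchyTransform (μ : Measure ℝ) (z : ℂ) : ℂ := ∫ t : ℝ, 1 / (z - (t : ℂ)) ∂μ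

/-- `θ_μ(y) = -y Im G_μ(iy)`. -/
noncomputable def theta (μ : Measure ℝ) (y : ℝ) : ℝ :=
  -y * (cauchyTransform μ (Complex.I * (y : ℂ))).im

/-! ### Operator-valued `C*`-probability spaces -/

/-- An operator-valued `C*`-probability space `(A, E, B)`: the unital `C*`-algebra `B` is unitally
embedded in the unital `C*`-algebra `A`, and `E : A → B` is a conditional expectation. -/
structure OpValuedProbSpace (A : Type u) (B : Type v)
    [CStarAlgebra A] [PartialOrder A] [StarOrderedRing A]
    [CStarAlgebra B] [PartialOrder B] [StarOrderedRing B] where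
  /-- the embedding of `B` as a unital `C*`-subalgebra of `A` -/
  incl : B →⋆ₐ[ℂ] A
  incl_injective : Function.Injective incl
  /-- the conditional expectation -/
  condExp : A →ₚ[ℂ] B
  condExp_incl : ∀ b : B, condExp (incl b) = b
  condExp_bimodule : ∀ (b₁ : B) (x : A) (b₂ : B),
    condExp (incl b₁ * x * incl b₂) = b₁ * condExp x * b₂

/-! ### Non-crossing pairings -/

/-- The non-crossing pairings of `{0, …, k - 1}`, a pairing being encoded by the fixed-point free
involution which exchanges the two elements of each block. -/
def NC₂ (k : ℕ) : Finset (Fin k → Fin k) :=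
  Finset.univ.filter fun π =>
    (∀ i, π i ≠ i) ∧ (∀ i, π (π i) = i) ∧ ∀ i j, i < j → j < π i → ¬ π i < π j

/-- Evaluation, according to the pairing `p`, of the part
`x b_i x b_{i+1} x ⋯ x b_{j-1}` (the letters `x` being at the positions `i, …, j - 1`) of a word:
if `i` is paired with `m`, then this is
`η(b_i ⬝ [value on the positions i+1, …, m-1]) ⬝ b_m ⬝ [value on the positions m+1, …, j-1]`,
and the value on the empty interval is `1`. -/
def evalPairing {B : Type v} [Ring B] (η : B → B) (p : ℕ → ℕ) (b : ℕ → B) (i j : ℕ) : B :=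
  if _h : i < p i ∧ p i < j then
    η (b i * evalPairing η p b (i + 1) (p i)) * b (p i) * evalPairing η p b (p i + 1) j
  else 1
termination_by j - i

/-- `η_π(b_0, …, b_{n-1})` for a pairing `π` of the `n + 1` letters of the word
`x b_0 x b_1 ⋯ x b_{n-1} x`; no coefficient follows the last letter. -/
def covPairing {B : Type v} [Ring B] (η : B → B) {n : ℕ} (π : Fin (n + 1) → Fin (n + 1))
    (b : Fin n → B) : B :=
  evalPairing η (fun i => if h : i < n + 1 then (π ⟨i, h⟩ : ℕ) else i)
    (fun i => if h : i < n then b ⟨i, h⟩ else 1) 0 (n + 1)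

/-! ### Operator-valued semicircular elements -/

namespace OpValuedProbSpace

variable {A : Type u} {B : Type v} [CStarAlgebra A] [PartialOrder A] [StarOrderedRing A]
  [CStarAlgebra B] [PartialOrder B] [StarOrderedRing B]

/-- The word `x b_0 x b_1 ⋯ x b_{n-1} x`. -/
def word (P : OpValuedProbSpace A B) (x : A) {n : ℕ} (b : Fin n → B) : A :=
  (List.ofFn fun i => x * P.incl (b i)).prod * x

/-- `x` is a centered `B`-valued semicircular element with covariance `η`: it is selfadjoint and
`E[x b_1 x ⋯ x b_{k-1} x] = ∑_{π ∈ NC₂(k)} η_π(b_1, …, b_{k-1})` for all `k ≥ 1`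
(below, `k = n + 1`). -/
def IsCenteredSemicircular (P : OpValuedProbSpace A B) (η : B →CP B) (x : A) : Prop :=
  IsSelfAdjoint x ∧ ∀ (n : ℕ) (b : Fin n → B),
    P.condExp (P.word x b) = ∑ π ∈ NC₂ (n + 1), covPairing η π b

/-- `s` is a (not necessarily centered) `B`-valued semicircular element with covariance `η`. -/
def IsSemicircular (P : OpValuedProbSpace A B) (η : B →CP B) (s : A) : Prop :=
  IsSelfAdjoint s ∧ P.IsCenteredSemicircular η (s - P.incl (P.condExp s))

theorem condExp_one (P : OpValuedProbSpace A B) : P.condExp 1 = 1 := by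
  simpa using P.condExp_incl 1

/-- The state `φ ∘ E` on `A` for a state `φ` on `B`. -/
noncomputable def compState (P : OpValuedProbSpace A B) (φ : CStarState B) : CStarState A :=
  .ofPositive (φ.toPositive.comp P.condExp) (by
    change φ (P.condExp 1) = 1
    rw [P.condExp_one, φ.map_one])

@[simp] theorem compState_apply (P : OpValuedProbSpace A B) (φ : CStarState B) (a : A) :
    P.compState φ a = φ (P.condExp a) := rfl

end OpValuedProbSpace

/-! ### The lower half-plane and the defect `Δ_b` -/

section HalfPlane

/-- The lower half-plane `H⁻(B) = {w | ∃ δ > 0, -Im w ≥ δ 1}`, `Im w = (w - w⋆) / (2i)`. -/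
def lowerHalfPlane (B : Type v) [CStarAlgebra B] [PartialOrder B] : Set B :=
  {w | ∃ δ : ℝ, 0 < δ ∧ δ • (1 : B) ≤ -(ℑ w : B)}

/-- `Δ_b(w) = b - w⁻¹ - η(w)` (elements of the lower half-plane are invertible). -/
noncomputable def defect {B : Type v} [CStarAlgebra B] (η : B → B) (b w : B) : B := b - Ring.inverse w - η w

end HalfPlane

end FreeProb

/-! Put `D = Δ_b(w)`. By definition of the defect, `w` solves `w⁻¹ = (b - D) - η(w)` exactly, so an
approximate solution at `b` is an exact solution at the perturbed point `b - D`, and `Im (b - D) ≥ y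
- ‖D‖ > 0`. At such a point the equation has only one solution in the lower half-plane, the
operator-valued Cauchy transform of `s° = s - E[s]`. Hence `w = E[r₁]` with `r₁ = (b - D - s°)⁻¹ =
(iy - s - D)⁻¹`. With `r₀ = (iy - s)⁻¹` the resolvent identity reads `r₀ - r₁ = -r₀ D r₁`.
Cauchy-Schwarz for `f = φ ∘ E` bounds `|f(r₀ - r₁)|` by `f(r₀ r₀⋆)^(1/2) ‖D‖ / (y - ‖D‖)`. Since `y²
f(r₀ r₀⋆) = θ(y)` and `-y Im f(r₀) = θ(y)`, multiplication by `y` gives the error bound `√θ(y) ‖D‖ /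
(y - ‖D‖)`, and the last factor is below `ε` by hypothesis (`abs_theta_sub_le`). Existence
(`IsCenteredSemicircular.dyson`): when the imaginary part is large, the resolvent is a Neumann
series whose moments obey a Catalan-type recursion, obtained by splitting a non-crossing pairing at
the block of its first letter; analytic continuation reaches the other points. Uniqueness
(`dyson_unique`): the difference of two solutions is fixed by `x ↦ w₁ η(x) w₂`. Complete positivity,
applied to 2×2 matrices, controls this map by the maps `w₁ η(·) w₁⋆` and `w₂⋆ η(·) w₂`, which
strictly contract `-Im w₁` and `-Im w₂`. -/

namespace FreeProb

/-! ### Imaginary parts, invertibility and resolvent bounds. -/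

section ImaginaryPart

variable {A : Type*} [CStarAlgebra A]

theorem coe_imaginaryPart_conj (a c : A) : (ℑ (star c * a * c) : A) = star c * (ℑ a : A) * c := by
  simp only [imaginaryPart_apply_coe, star_mul, star_star, mul_smul_comm, smul_mul_assoc,
    mul_sub, sub_mul, mul_assoc]

theorem coe_imaginaryPart_star (a : A) : (ℑ (star a) : A) = -(ℑ a : A) := by
  simp only [imaginaryPart_apply_coe, star_star, ← smul_neg, neg_sub]

theorem coe_imaginaryPart_of_isSelfAdjoint {a : A} (ha : IsSelfAdjoint a) : (ℑ a : A) = 0 := by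
  simp [imaginaryPart_apply_coe, ha.star_eq]

theorem coe_imaginaryPart_I_smul_one (y : ℝ) : (ℑ ((Complex.I * (y : ℂ)) • (1 : A)) : A) = y • 1 := by
  rw [mul_smul, imaginaryPart_I_smul, realPart_apply_coe, Complex.coe_smul, star_smul]
  simp only [star_one, star_trivial]
  rw [← two_smul ℝ, smul_smul]; norm_num

/-- The imaginary part of the inverse of `u`, if `u * v = 1`. -/
theorem neg_coe_imaginaryPart_of_mul_eq_one {u v : A} (h : u * v = 1) :
    -(ℑ v : A) = star v * (ℑ u : A) * v := by
  rw [← coe_imaginaryPart_conj, mul_assoc, h, mul_one, coe_imaginaryPart_star]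

theorem norm_coe_imaginaryPart_le (a : A) : ‖(ℑ a : A)‖ ≤ ‖a‖ :=
  imaginaryPart.norm_le a

theorem coe_imaginaryPart_map {B : Type*} [CStarAlgebra B] (f : A →ₗ[ℂ] B)
    (hf : ∀ x, f (star x) = star (f x)) (x : A) : f (ℑ x : A) = (ℑ (f x) : B) := by
  rw [imaginaryPart_apply_coe, imaginaryPart_apply_coe, map_smul, f.map_smul_of_tower, map_sub, hf]

variable [PartialOrder A] [StarOrderedRing A]

/-- Conjugation by `(Im a)^(-1/2)` turns `a` into `h + i` with `h` selfadjoint, and `-i` is not in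
the real spectrum of `h`. -/
theorem isUnit_of_le_imaginaryPart {a : A} {δ : ℝ} (hδ : 0 < δ) (ha : δ • (1 : A) ≤ ℑ a) :
    IsUnit a := by
  have hδ1 : IsStrictlyPositive (δ • (1 : A)) := IsStrictlyPositive.smul hδ isStrictlyPositive_one
  have hv : IsStrictlyPositive (ℑ a : A) := hδ1.of_le ha
  set r : A := (ℑ a : A) ^ (-(1 / 2) : ℝ) with hr
  have hr1 : r * (ℑ a : A) * r = 1 := CFC.conjugate_rpow_neg_one_half _ hv
  have hrpos : 0 ≤ r := CFC.rpow_nonneg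
  have hrsa : IsSelfAdjoint r := .of_nonneg hrpos
  have hru : IsUnit r := by
    have := hv
    cfc_tac
  set h : A := r * (ℜ a : A) * r with hh
  have hsa : IsSelfAdjoint h := by
    have := (ℜ a).2.conjugate r
    rwa [hrsa.star_eq] at this
  have hI : IsUnit (h + Complex.I • (1 : A)) := by
    have h1 : (-Complex.I) ∉ spectrum ℂ h := fun hmem => by
      have := hsa.im_eq_zero_of_mem_spectrum hmem
      simp at this
    rw [spectrum.notMem_iff] at h1
    have h2 : h + Complex.I • (1 : A) = -(algebraMap ℂ A (-Complex.I) - h) := by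
      rw [Algebra.algebraMap_eq_smul_one, neg_smul]; abel
    rw [h2]; exact h1.neg
  have h3 : r * a * r = h + Complex.I • (1 : A) := by
    conv_lhs => rw [← realPart_add_I_smul_imaginaryPart a]
    rw [mul_add, add_mul, mul_smul_comm, smul_mul_assoc, hr1]
  rw [← h3] at hI
  obtain ⟨u, hu⟩ := hru
  rw [← hu, Units.isUnit_mul_units, Units.isUnit_units_mul] at hI
  exact hI

/-- From `-Im v = v⋆ (Im u) v ≥ δ v⋆v` one gets `δ ‖v‖² ≤ ‖Im v‖ ≤ ‖v‖`. -/
theorem norm_le_of_le_imaginaryPart {u v : A} {δ : ℝ} (hδ : 0 < δ) (hu : δ • (1 : A) ≤ ℑ u)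
    (h : u * v = 1) : ‖v‖ ≤ δ⁻¹ := by
  have h1 : δ • (star v * v) ≤ -(ℑ v : A) := by
    rw [neg_coe_imaginaryPart_of_mul_eq_one h]
    simpa using star_left_conjugate_le_conjugate hu v
  have h2 := CStarAlgebra.norm_le_norm_of_nonneg_of_le
    (smul_nonneg hδ.le (star_mul_self_nonneg v)) h1
  rw [norm_smul, norm_neg, CStarRing.norm_star_mul_self, Real.norm_of_nonneg hδ.le] at h2
  have h3 := h2.trans (norm_coe_imaginaryPart_le v)
  rcases (norm_nonneg v).eq_or_lt with h0 | h0
  · rw [← h0]; positivity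
  · rw [← one_div, le_div_iff₀ hδ]
    nlinarith

/-- A lower bound for `v⋆ v` if `v` has a left inverse. -/
theorem one_le_smul_star_mul_self {u v : A} (h : u * v = 1) :
    (1 : A) ≤ (‖u‖ ^ 2) • (star v * v) := by
  have h1 : star u * u ≤ (‖u‖ ^ 2) • (1 : A) := by
    rw [← Algebra.algebraMap_eq_smul_one]; exact CStarAlgebra.star_mul_le_algebraMap_norm_sq
  have h2 := star_left_conjugate_le_conjugate h1 v
  have h3 : star v * (star u * u) * v = 1 := by
    rw [show star v * (star u * u) * v = star (u * v) * (u * v) by simp [mul_assoc], h]; simp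
  rw [h3] at h2
  simpa using h2

theorem neg_norm_smul_one_le {a : A} (ha : IsSelfAdjoint a) : -(‖a‖ • (1 : A)) ≤ a := by
  rw [← Algebra.algebraMap_eq_smul_one]; exact ha.neg_algebraMap_norm_le_self

theorem le_norm_smul_one {a : A} (ha : IsSelfAdjoint a) : a ≤ ‖a‖ • (1 : A) := by
  rw [← Algebra.algebraMap_eq_smul_one]; exact ha.le_algebraMap_norm_self

/-- If `δ ≤ Im u` then the inverse of `u` lies in the lower half-plane. -/
theorem inverse_mem_lowerHalfPlane {u v : A} {δ : ℝ} (hδ : 0 < δ) (hu : δ • (1 : A) ≤ ℑ u)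
    (h : u * v = 1) : v ∈ lowerHalfPlane A := by
  -- The `+ 1` keeps the constant positive even when `u = 0`, which happens in the zero algebra.
  refine ⟨δ * (‖u‖ ^ 2 + 1)⁻¹, by positivity, ?_⟩
  rw [neg_coe_imaginaryPart_of_mul_eq_one h]
  have h1 : δ • (star v * v) ≤ star v * (ℑ u : A) * v := by
    simpa using star_left_conjugate_le_conjugate hu v
  refine le_trans ?_ h1
  rw [mul_smul]
  refine smul_le_smul_of_nonneg_left ?_ hδ.le
  have h2 : (1 : A) ≤ (‖u‖ ^ 2 + 1) • (star v * v) := by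
    rw [add_smul, one_smul]
    exact (one_le_smul_star_mul_self h).trans (le_add_of_nonneg_right (star_mul_self_nonneg v))
  rwa [inv_smul_le_iff_of_pos (by positivity)]

theorem isUnit_of_mem_lowerHalfPlane {w : A} (hw : w ∈ lowerHalfPlane A) : IsUnit w := by
  obtain ⟨δ, hδ, h⟩ := hw
  have : IsUnit (-w) := isUnit_of_le_imaginaryPart hδ (by simpa using h)
  simpa using this.neg

end ImaginaryPart

/-! ### Strict contraction of `-Im w`. -/

section Contraction

variable {A : Type*} [CStarAlgebra A] [PartialOrder A] [StarOrderedRing A]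

/-- Used with `e = η(-Im w)`. Conjugating the bound on `Im u` by `w` gives `δ w⋆w + w⋆ew ≤ -Im w`;
as `w⋆w` is bounded below, the term `δ w⋆w` absorbs a fixed proportion `κ` of `-Im w`. -/
theorem exists_contraction_left {u w e : A} {δ : ℝ} (hδ : 0 < δ) (huw : u * w = 1)
    (hu : δ • (1 : A) + e ≤ ℑ u) :
    ∃ κ : ℝ, 0 < κ ∧ κ ≤ 1 ∧ star w * e * w ≤ (1 - κ) • (-(ℑ w : A)) := by
  set v : A := -(ℑ w : A) with hv
  have hvsa : IsSelfAdjoint v := (ℑ w).2.neg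
  have hC : 0 < (‖u‖ ^ 2 + 1) * (‖v‖ + 1) + δ := by positivity
  -- The denominator has to dominate `‖v‖ ‖u‖²`, so that `v` is at most that multiple of `w⋆w`; its
  -- summand `δ` ensures `κ ≤ 1`.
  set κ : ℝ := δ * ((‖u‖ ^ 2 + 1) * (‖v‖ + 1) + δ)⁻¹ with hκ
  refine ⟨κ, by positivity, ?_, ?_⟩
  · rw [hκ, ← div_eq_mul_inv, div_le_one hC]
    nlinarith [mul_pos (show 0 < ‖u‖ ^ 2 + 1 by positivity) (show 0 < ‖v‖ + 1 by positivity)]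
  have h1 : δ • (star w * w) + star w * e * w ≤ v := by
    rw [hv, neg_coe_imaginaryPart_of_mul_eq_one huw]
    simpa [mul_add, add_mul] using star_left_conjugate_le_conjugate hu w
  have hww : 0 ≤ star w * w := star_mul_self_nonneg w
  have h2 : v ≤ ((‖u‖ ^ 2 + 1) * (‖v‖ + 1) + δ) • (star w * w) := by
    calc v ≤ ‖v‖ • (1 : A) := le_norm_smul_one hvsa
      _ ≤ ‖v‖ • ((‖u‖ ^ 2) • (star w * w)) :=
          smul_le_smul_of_nonneg_left (one_le_smul_star_mul_self huw) (norm_nonneg v)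
      _ = (‖v‖ * ‖u‖ ^ 2) • (star w * w) := by rw [smul_smul]
      _ ≤ _ := smul_le_smul_of_nonneg_right (by nlinarith [norm_nonneg v, sq_nonneg ‖u‖]) hww
  have h3 : κ • v ≤ δ • (star w * w) := by
    rw [hκ, mul_smul]
    refine smul_le_smul_of_nonneg_left ?_ hδ.le
    rwa [inv_smul_le_iff_of_pos hC]
  calc star w * e * w = (δ • (star w * w) + star w * e * w) - δ • (star w * w) := by abel
    _ ≤ v - κ • v := sub_le_sub h1 h3
    _ = (1 - κ) • v := by rw [sub_smul, one_smul]

/-- The map `a ↦ -a⋆` reverses products up to sign and preserves imaginary parts, so it exchanges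
the left and right versions. -/
theorem exists_contraction_right {u w e : A} {δ : ℝ} (hδ : 0 < δ) (hwu : w * u = 1)
    (hu : δ • (1 : A) + e ≤ ℑ u) :
    ∃ κ : ℝ, 0 < κ ∧ κ ≤ 1 ∧ w * e * star w ≤ (1 - κ) • (-(ℑ w : A)) := by
  have h := exists_contraction_left (u := -star u) (w := -star w) (e := e) hδ
    (by rw [neg_mul_neg, ← star_mul, hwu, star_one])
    (by rw [map_neg, NegMemClass.coe_neg, coe_imaginaryPart_star, neg_neg]; exact hu)
  rw [map_neg, NegMemClass.coe_neg, coe_imaginaryPart_star, neg_neg] at h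
  simpa using h

end Contraction

/-! ### 2×2 block matrices and uniqueness for the Dyson equation. -/

section Block

variable {B : Type*} [CStarAlgebra B]

/-- The selfadjoint block matrix with upper right corner `x` and diagonal `a, d`. -/
def blockMatrix (a x d : B) : CStarMatrix (Fin 2) (Fin 2) B :=
  CStarMatrix.ofMatrix !![a, x; star x, d]

theorem blockMatrix_add (a x d a' x' d' : B) :
    blockMatrix a x d + blockMatrix a' x' d' = blockMatrix (a + a') (x + x') (d + d') := by
  ext i j
  fin_cases i <;> fin_cases j <;> simp [blockMatrix]

theorem smul_blockMatrix (t : ℝ) (a d : B) :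
    t • blockMatrix a 0 d = blockMatrix (t • a) 0 (t • d) := by
  ext i j
  fin_cases i <;> fin_cases j <;> simp [blockMatrix]

theorem blockMatrix_one : blockMatrix (1 : B) 0 1 = 1 := by
  ext i j
  fin_cases i <;> fin_cases j <;> simp [blockMatrix]

theorem neg_blockMatrix (x : B) : -blockMatrix 0 x 0 = blockMatrix 0 (-x) 0 := by
  ext i j
  fin_cases i <;> fin_cases j <;> simp [blockMatrix]

theorem isSelfAdjoint_blockMatrix (x : B) : IsSelfAdjoint (blockMatrix 0 x 0) := by
  ext i j
  fin_cases i <;> fin_cases j <;> simp [blockMatrix, CStarMatrix.star_apply]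

theorem blockMatrix_conj (p q a x d : B) :
    star (blockMatrix (star p) 0 q) * blockMatrix a x d * blockMatrix (star p) 0 q =
      blockMatrix (p * a * star p) (p * x * q) (star q * d * q) := by
  ext i j
  fin_cases i <;> fin_cases j <;>
    simp [blockMatrix, CStarMatrix.star_apply, CStarMatrix.mul_apply, mul_assoc]

variable [PartialOrder B] [StarOrderedRing B]

theorem blockMatrix_nonneg {a d : B} (ha : 0 ≤ a) (hd : 0 ≤ d) : 0 ≤ blockMatrix a 0 d := by
  obtain ⟨p, rfl⟩ := CStarAlgebra.nonneg_iff_eq_star_mul_self.mp ha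
  obtain ⟨q, rfl⟩ := CStarAlgebra.nonneg_iff_eq_star_mul_self.mp hd
  have h := star_mul_self_nonneg (blockMatrix p 0 q)
  convert h using 1
  ext i j
  fin_cases i <;> fin_cases j <;>
    simp [blockMatrix, CStarMatrix.star_apply, CStarMatrix.mul_apply]

/-- The only place where more than positivity of `η` is needed, namely 2-positivity. -/
theorem blockMatrix_map_nonneg (η : B →CP B) {a x d : B} (h : 0 ≤ blockMatrix a x d) :
    0 ≤ blockMatrix (η a) (η x) (η d) := by
  convert η.map_cstarMatrix_nonneg _ h using 1
  ext i j
  fin_cases i <;> fin_cases j <;> simp [blockMatrix, map_star]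

/-- A fixed point of `x ↦ w₁ η(x) w₂` vanishes if `x ↦ w₁ η(x) w₁⋆` and `x ↦ w₂⋆ η(x) w₂`
contract strictly positive elements. -/
theorem eq_zero_of_mul_map_mul_eq (η : B →CP B) {w₁ w₂ v₁ v₂ x : B} {δ c : ℝ} (hδ : 0 < δ)
    (hc : 0 ≤ c) (hc1 : c < 1) (hv₁ : δ • (1 : B) ≤ v₁) (hv₂ : δ • (1 : B) ≤ v₂)
    (h₁ : w₁ * η v₁ * star w₁ ≤ c • v₁) (h₂ : star w₂ * η v₂ * w₂ ≤ c • v₂)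
    (hx : w₁ * η x * w₂ = x) : x = 0 := by
  -- Apply `η` entrywise and conjugate by `diag(w₁⋆, w₂)`: the corner returns to `z` because `z` is
  -- a fixed point, while the diagonal shrinks by the factor `c`.
  have step : ∀ z : B, w₁ * η z * w₂ = z → ∀ t : ℝ, 0 ≤ t →
      0 ≤ t • blockMatrix v₁ 0 v₂ + blockMatrix 0 z 0 →
      0 ≤ (c * t) • blockMatrix v₁ 0 v₂ + blockMatrix 0 z 0 := by
    intro z hz t ht h
    simp only [smul_blockMatrix, blockMatrix_add, add_zero, zero_add] at h ⊢
    have h3 := star_left_conjugate_nonneg (blockMatrix_map_nonneg η h)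
      (blockMatrix (star w₁) 0 w₂)
    rw [blockMatrix_conj, hz] at h3
    have h4 : ∀ v : B, η (t • v) = t • η v := fun v => by
      rw [← Complex.coe_smul, map_smul, Complex.coe_smul]
    rw [h4, h4] at h3
    have h5 := add_nonneg h3 (blockMatrix_nonneg
      (sub_nonneg.mpr (smul_le_smul_of_nonneg_left h₁ ht))
      (sub_nonneg.mpr (smul_le_smul_of_nonneg_left h₂ ht)))
    rw [blockMatrix_add] at h5
    simpa [smul_smul, mul_comm c t] using h5
  have start : ∀ z : B, ∃ t : ℝ, 0 ≤ t ∧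
      0 ≤ t • blockMatrix v₁ 0 v₂ + blockMatrix 0 z 0 := by
    intro z
    set m := ‖blockMatrix 0 z 0‖ with hm
    refine ⟨m * δ⁻¹, by positivity, ?_⟩
    have h3 : 0 ≤ m • (1 : CStarMatrix (Fin 2) (Fin 2) B) + blockMatrix 0 z 0 := by
      have := neg_norm_smul_one_le (isSelfAdjoint_blockMatrix z)
      rwa [neg_le_iff_add_nonneg'] at this
    have h4 : ∀ v : B, δ • (1 : B) ≤ v → 0 ≤ (m * δ⁻¹) • v - m • 1 := fun v hv => by
      rw [sub_nonneg]
      calc m • (1 : B) = (m * δ⁻¹) • (δ • (1 : B)) := by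
            rw [smul_smul, mul_assoc, inv_mul_cancel₀ hδ.ne', mul_one]
        _ ≤ _ := smul_le_smul_of_nonneg_left hv (by positivity)
    have h5 := add_nonneg h3 (blockMatrix_nonneg (h4 v₁ hv₁) (h4 v₂ hv₂))
    rw [← blockMatrix_one, smul_blockMatrix, blockMatrix_add, blockMatrix_add] at h5
    rw [smul_blockMatrix, blockMatrix_add]
    simpa using h5
  -- Iterating drives the diagonal to zero and leaves the corner unchanged, so the purely
  -- off-diagonal matrix is itself nonnegative. The same holds for `-x`, which forces `x = 0`.
  have nonneg : ∀ z : B, w₁ * η z * w₂ = z → 0 ≤ blockMatrix 0 z 0 := by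
    intro z hz
    obtain ⟨t, ht, h⟩ := start z
    have hn : ∀ n : ℕ, 0 ≤ (c ^ n * t) • blockMatrix v₁ 0 v₂ + blockMatrix 0 z 0 := by
      intro n
      induction n with
      | zero => simpa using h
      | succ n ih =>
        rw [pow_succ', mul_assoc]
        exact step z hz _ (by positivity) ih
    have hlim : Filter.Tendsto
        (fun n : ℕ => (c ^ n * t) • blockMatrix v₁ 0 v₂ + blockMatrix 0 z 0) Filter.atTop
        (nhds ((0 * t) • blockMatrix v₁ 0 v₂ + blockMatrix 0 z 0)) :=
      (((tendsto_pow_atTop_nhds_zero_of_lt_one hc hc1).mul_const t).smul_const _).add_const _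
    rw [zero_mul, zero_smul, zero_add] at hlim
    exact CStarAlgebra.isClosed_nonneg.mem_of_tendsto hlim (Filter.Eventually.of_forall hn)
  have hneg : 0 ≤ -blockMatrix 0 x 0 := by
    rw [neg_blockMatrix]
    exact nonneg (-x) (by rw [map_neg, mul_neg, neg_mul, hx])
  have h0 := le_antisymm (neg_nonneg.mp hneg) (nonneg x hx)
  simpa [blockMatrix] using congrArg (fun M : CStarMatrix (Fin 2) (Fin 2) B => M 0 1) h0

/-- Uniqueness of the solution in the lower half-plane of the equation `w⁻¹ = b - η(w)`. -/
theorem dyson_unique (η : B →CP B) {b w₁ w₂ : B} {δ : ℝ} (hδ : 0 < δ) (hb : δ • (1 : B) ≤ ℑ b)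
    (hw₁ : w₁ ∈ lowerHalfPlane B) (hw₂ : w₂ ∈ lowerHalfPlane B)
    (h₁ : w₁ * (b - η w₁) = 1) (h₂ : (b - η w₂) * w₂ = 1) : w₁ = w₂ := by
  -- Since `-Im η(w) = η(-Im w)`, this is the hypothesis of the contraction lemmas with `e = η(-Im
  -- w)`.
  have him : ∀ w : B, δ • (1 : B) + η (-(ℑ w : B)) ≤ ℑ (b - η w) := fun w => by
    have hη : η (ℑ w : B) = ℑ (η w) := coe_imaginaryPart_map (η : B →ₗ[ℂ] B) (map_star η) w
    rw [map_sub, AddSubgroupClass.coe_sub, ← hη, map_neg, ← sub_eq_add_neg]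
    exact sub_le_sub_right hb _
  obtain ⟨κ₁, hκ₁, hκ₁', hle₁⟩ := exists_contraction_right hδ h₁ (him w₁)
  obtain ⟨κ₂, hκ₂, hκ₂', hle₂⟩ := exists_contraction_left hδ h₂ (him w₂)
  obtain ⟨δ₁, hδ₁, hv₁⟩ := hw₁
  obtain ⟨δ₂, hδ₂, hv₂⟩ := hw₂
  have hone : (0 : B) ≤ 1 := zero_le_one
  have hv₁0 : (0 : B) ≤ -(ℑ w₁ : B) := (smul_nonneg hδ₁.le hone).trans hv₁
  have hv₂0 : (0 : B) ≤ -(ℑ w₂ : B) := (smul_nonneg hδ₂.le hone).trans hv₂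
  rw [← sub_eq_zero]
  refine eq_zero_of_mul_map_mul_eq η (δ := min δ₁ δ₂) (c := 1 - min κ₁ κ₂) (lt_min hδ₁ hδ₂)
    (by linarith [min_le_left κ₁ κ₂]) (by linarith [lt_min hκ₁ hκ₂])
    ((smul_le_smul_of_nonneg_right (min_le_left _ _) hone).trans hv₁)
    ((smul_le_smul_of_nonneg_right (min_le_right _ _) hone).trans hv₂)
    (hle₁.trans (smul_le_smul_of_nonneg_right (by linarith [min_le_left κ₁ κ₂]) hv₁0))
    (hle₂.trans (smul_le_smul_of_nonneg_right (by linarith [min_le_right κ₁ κ₂]) hv₂0)) ?_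
  calc w₁ * η (w₁ - w₂) * w₂ = w₁ * ((b - η w₂) * w₂) - w₁ * (b - η w₁) * w₂ := by
        rw [map_sub]; noncomm_ring
    _ = w₁ - w₂ := by rw [h₁, h₂, mul_one, one_mul]

end Block

/-! ### Recursion for sums over non-crossing pairings. -/

section NonCrossing

/-- The non-crossing pairings of the interval `[i, j)`, extended by the identity. -/
def intervalPairings (i j : ℕ) : Set (ℕ → ℕ) :=
  {p | (∀ l, l < i ∨ j ≤ l → p l = l) ∧
    (∀ l, i ≤ l → l < j → i ≤ p l ∧ p l < j ∧ p l ≠ l ∧ p (p l) = l) ∧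
    ∀ k l, k < l → l < p k → p l ≤ p k}

theorem finite_intervalPairings (i j : ℕ) : (intervalPairings i j).Finite := by
  refine Set.Finite.of_finite_image (f := fun p (l : Fin j) => p l)
    ((Set.finite_Iic (fun _ : Fin j => j)).subset ?_) ?_
  · rintro _ ⟨p, hp, rfl⟩ l
    by_cases h : i ≤ l
    · exact (hp.2.1 l h l.2).2.1.le
    · have := hp.1 l (by omega)
      have := l.2
      simp only; omega
  · intro p hp q hq h
    funext l
    by_cases hl : l < j
    · exact congrFun h ⟨l, hl⟩
    · rw [hp.1 l (by omega), hq.1 l (by omega)]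

/-- The non-crossing pairings of `[i, j)` as a finite set. -/
noncomputable def intervalPairingsFinset (i j : ℕ) : Finset (ℕ → ℕ) :=
  (finite_intervalPairings i j).toFinset

theorem mem_intervalPairingsFinset {i j : ℕ} {p : ℕ → ℕ} :
    p ∈ intervalPairingsFinset i j ↔ p ∈ intervalPairings i j :=
  (finite_intervalPairings i j).mem_toFinset

/-- The pairing with block `{i, m}` which is given by `p` before `m` and by `q` after `m`. -/
def gluePairing (i m : ℕ) (p q : ℕ → ℕ) (l : ℕ) : ℕ :=
  if l = i then m else if l = m then i else if l < m then p l else q l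

/-- The part of a pairing inside the block `{i, m}`. -/
def innerPairing (i m : ℕ) (p : ℕ → ℕ) (l : ℕ) : ℕ := if i < l ∧ l < m then p l else l

/-- The part of a pairing after `m`. -/
def outerPairing (m : ℕ) (p : ℕ → ℕ) (l : ℕ) : ℕ := if m < l then p l else l

variable {i j m : ℕ}

theorem gluePairing_mem {p q : ℕ → ℕ} (him : i < m) (hmj : m < j)
    (hp : p ∈ intervalPairings (i + 1) m) (hq : q ∈ intervalPairings (m + 1) j) :
    gluePairing i m p q ∈ intervalPairings i j := by
  obtain ⟨hp1, hp2, hp3⟩ := hp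
  obtain ⟨hq1, hq2, hq3⟩ := hq
  have hin : ∀ l, i < l → l < m → gluePairing i m p q l = p l := fun l h1 h2 => by
    rw [gluePairing, if_neg h1.ne', if_neg h2.ne, if_pos h2]
  have hout : ∀ l, m < l → gluePairing i m p q l = q l := fun l h => by
    rw [gluePairing, if_neg (by omega), if_neg (by omega), if_neg (by omega)]
  have hi : gluePairing i m p q i = m := by simp [gluePairing]
  have hm : gluePairing i m p q m = i := by simp [gluePairing, him.ne']
  have hlow : ∀ l, l < i → gluePairing i m p q l = l := fun l h => by
    rw [gluePairing, if_neg (by omega), if_neg (by omega), if_pos (by omega), hp1 l (by omega)]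
  have hhigh : ∀ l, j ≤ l → gluePairing i m p q l = l := fun l h => by
    rw [hout l (by omega), hq1 l (by omega)]
  have cases : ∀ l, i ≤ l → l < j → l = i ∨ (i < l ∧ l < m) ∨ l = m ∨ m < l := fun l _ _ => by
    omega
  refine ⟨fun l hl => hl.elim (hlow l) (hhigh l), fun l hil hlj => ?_, fun k l hkl hl => ?_⟩
  · rcases cases l hil hlj with rfl | ⟨h1, h2⟩ | rfl | h
    · rw [hi, hm]; omega
    · obtain ⟨h3, h4, h5, h6⟩ := hp2 l h1 h2
      rw [hin l h1 h2, hin (p l) (by omega) h4]; omega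
    · rw [hm, hi]; omega
    · obtain ⟨h3, h4, h5, h6⟩ := hq2 l h hlj
      rw [hout l h, hout (q l) (by omega)]; omega
  · by_cases hk : k < i
    · rw [hlow k hk] at hl; omega
    by_cases hk' : j ≤ k
    · rw [hhigh k hk'] at hl; omega
    rcases cases k (by omega) (by omega) with rfl | ⟨h1, h2⟩ | rfl | h
    · rw [hi] at hl ⊢
      obtain ⟨h3, h4, -, -⟩ := hp2 l (by omega) (by omega)
      rw [hin l hkl hl]; omega
    · obtain ⟨h3, h4, -, -⟩ := hp2 k h1 h2
      rw [hin k h1 h2] at hl ⊢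
      rw [hin l (by omega) (by omega)]
      exact hp3 k l hkl hl
    · rw [hm] at hl; omega
    · rw [hout k h] at hl ⊢
      rw [hout l (by omega)]
      exact hq3 k l hkl hl

/-- Non-crossing with the block `{i, m}` keeps partners of points between `i` and `m` in between; as
`p` is an involution, points beyond `m` then have their partners beyond `m`. -/
theorem innerPairing_mem_and_outerPairing_mem {p : ℕ → ℕ} (hp : p ∈ intervalPairings i j)
    (hij : i < j) (hm : p i = m) :
    innerPairing i m p ∈ intervalPairings (i + 1) m ∧
      outerPairing m p ∈ intervalPairings (m + 1) j ∧
      gluePairing i m (innerPairing i m p) (outerPairing m p) = p := by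
  obtain ⟨hp1, hp2, hp3⟩ := hp
  obtain ⟨h1, h2, h3, h4⟩ := hp2 i le_rfl hij
  rw [hm] at h1 h2 h3 h4
  have hin : ∀ l, i < l → l < m → i < p l ∧ p l < m := fun l hl hl' => by
    have h5 := hp3 i l hl (by omega)
    obtain ⟨h6, -, -, h7⟩ := hp2 l (by omega) (by omega)
    have h8 : p l ≠ m := fun h => by rw [h] at h7; omega
    have h9 : p l ≠ i := fun h => by rw [h] at h7; omega
    omega
  have hout : ∀ l, m < l → l < j → m < p l := fun l hl hl' => by
    obtain ⟨h6, -, -, h7⟩ := hp2 l (by omega) (by omega)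
    have h8 : p l ≠ m := fun h => by rw [h] at h7; omega
    have h9 : p l ≠ i := fun h => by rw [h] at h7; omega
    by_contra hlt
    have := hin (p l) (by omega) (by omega)
    omega
  have hI : ∀ l, i < l → l < m → innerPairing i m p l = p l := fun l h h' => if_pos ⟨h, h'⟩
  have hI' : ∀ l, ¬ (i < l ∧ l < m) → innerPairing i m p l = l := fun l h => if_neg h
  have hO : ∀ l, m < l → outerPairing m p l = p l := fun l h => if_pos h
  have hO' : ∀ l, ¬ m < l → outerPairing m p l = l := fun l h => if_neg h
  refine ⟨⟨fun l hl => hI' l (by omega), fun l hl hl' => ?_, fun k l hkl hl => ?_⟩,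
    ⟨fun l hl => ?_, fun l hl hl' => ?_, fun k l hkl hl => ?_⟩, ?_⟩
  · obtain ⟨h5, h6⟩ := hin l hl hl'
    have := hp2 l (by omega) (by omega)
    rw [hI l hl hl', hI _ h5 h6]; omega
  · by_cases hk : i < k ∧ k < m
    · have := hin k hk.1 hk.2
      rw [hI k hk.1 hk.2] at hl ⊢
      rw [hI l (by omega) (by omega)]
      exact hp3 k l hkl hl
    · rw [hI' k hk] at hl; omega
  · by_cases h : m < l
    · rw [hO l h, hp1 l (by omega)]
    · exact hO' l h
  · have h5 := hout l hl hl'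
    have := hp2 l (by omega) (by omega)
    rw [hO l hl, hO _ h5]; omega
  · by_cases hk : m < k
    · rw [hO k hk] at hl ⊢
      rw [hO l (by omega)]
      exact hp3 k l hkl hl
    · rw [hO' k hk] at hl; omega
  · funext l
    rw [gluePairing]
    split_ifs with h5 h6 h7
    · rw [h5, hm]
    · rw [h6, h4]
    · by_cases hl : i < l
      · exact hI l hl h7
      · rw [hI' l (by omega), hp1 l (by omega)]
    · exact hO l (by omega)

variable {B : Type*} [Ring B]

theorem evalPairing_congr (η : B → B) {p p' : ℕ → ℕ} {b b' : ℕ → B} (i j : ℕ)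
    (hp : ∀ l, i ≤ l → l < j → p l = p' l) (hb : ∀ l, i ≤ l → l < j → b l = b' l) :
    evalPairing η p b i j = evalPairing η p' b' i j := by
  rw [evalPairing.eq_def η p b i j, evalPairing.eq_def η p' b' i j]
  by_cases hij : i < j
  · rw [← hp i le_rfl hij]
    split_ifs with h
    · rw [evalPairing_congr η (i + 1) (p i) (fun l _ _ => hp l (by omega) (by omega))
          (fun l _ _ => hb l (by omega) (by omega)),
        evalPairing_congr η (p i + 1) j (fun l _ _ => hp l (by omega) (by omega))
          (fun l _ _ => hb l (by omega) (by omega)), hb i le_rfl hij, hb (p i) h.1.le h.2]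
    · rfl
  · rw [dif_neg (by omega), dif_neg (by omega)]
termination_by j - i

/-- The sum of `evalPairing` over the non-crossing pairings of `[i, j)`. -/
noncomputable def sumPairings (η : B → B) (b : ℕ → B) (i j : ℕ) : B :=
  ∑ p ∈ intervalPairingsFinset i j, evalPairing η p b i j

theorem sumPairings_self (η : B → B) (b : ℕ → B) (i : ℕ) : sumPairings η b i i = 1 := by
  have : intervalPairingsFinset i i = {id} := by
    ext p
    rw [mem_intervalPairingsFinset, Finset.mem_singleton]
    constructor
    · rintro ⟨h, -, -⟩
      exact funext fun l => h l (by omega)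
    · rintro rfl
      exact ⟨fun _ _ => rfl, fun l _ _ => by omega, fun k l h h' => by simp at h'; omega⟩
  rw [sumPairings, this, Finset.sum_singleton, evalPairing, dif_neg (by omega)]

/-- Sort the pairings by the partner `m` of `i`. The parts inside and after `{i, m}` vary
independently, so additivity of `η` factors each fibre sum. -/
theorem sumPairings_eq_sum_Ioo (η : B →+ B) (b : ℕ → B) (hij : i < j) :
    sumPairings η b i j = ∑ m ∈ Finset.Ioo i j,
      η (b i * sumPairings η b (i + 1) m) * b m * sumPairings η b (m + 1) j := by
  rw [sumPairings, ← Finset.sum_fiberwise_of_maps_to (t := Finset.Ioo i j) (g := fun p => p i)]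
  · refine Finset.sum_congr rfl fun m hm => ?_
    rw [Finset.mem_Ioo] at hm
    simp only [sumPairings]
    rw [Finset.mul_sum (s := intervalPairingsFinset (i + 1) m), map_sum, Finset.sum_mul,
      Finset.sum_mul_sum, ← Finset.sum_product']
    refine Finset.sum_bij' (fun p _ => (innerPairing i m p, outerPairing m p))
      (fun q _ => gluePairing i m q.1 q.2) ?_ ?_ ?_ ?_ ?_
    · intro p hp
      simp only [Finset.mem_filter, mem_intervalPairingsFinset, Finset.mem_product] at hp ⊢
      have := innerPairing_mem_and_outerPairing_mem hp.1 hij hp.2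
      exact ⟨this.1, this.2.1⟩
    · intro q hq
      simp only [Finset.mem_filter, mem_intervalPairingsFinset, Finset.mem_product] at hq ⊢
      exact ⟨gluePairing_mem hm.1 hm.2 hq.1 hq.2, by simp [gluePairing]⟩
    · intro p hp
      simp only [Finset.mem_filter, mem_intervalPairingsFinset] at hp
      exact (innerPairing_mem_and_outerPairing_mem hp.1 hij hp.2).2.2
    · rintro ⟨p, q⟩ hq
      simp only [mem_intervalPairingsFinset, Finset.mem_product] at hq
      refine Prod.ext (funext fun l => ?_) (funext fun l => ?_)
      · simp only [innerPairing, gluePairing]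
        split_ifs <;> first | rfl | omega | exact (hq.1.1 l (by omega)).symm
      · simp only [outerPairing, gluePairing]
        split_ifs <;> first | rfl | omega | exact (hq.2.1 l (by omega)).symm
    · intro p hp
      simp only [Finset.mem_filter, mem_intervalPairingsFinset] at hp
      rw [evalPairing, dif_pos (by omega), hp.2]
      rw [evalPairing_congr η (p' := innerPairing i m p) (b' := b) (i + 1) m
          (fun l _ _ => by rw [innerPairing, if_pos (by omega)]) (fun _ _ _ => rfl),
        evalPairing_congr η (p' := outerPairing m p) (b' := b) (m + 1) j
          (fun l _ _ => by rw [outerPairing, if_pos (by omega)]) (fun _ _ _ => rfl)]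
  · intro p hp
    rw [mem_intervalPairingsFinset] at hp
    have := hp.2.1 i le_rfl hij
    rw [Finset.mem_Ioo]; omega

theorem sumPairings_succ (η : B →+ B) (b : ℕ → B) (i k : ℕ) :
    sumPairings η b i (i + k + 1) = ∑ a ∈ Finset.range k,
      η (b i * sumPairings η b (i + 1) (i + 1 + a)) * b (i + 1 + a) *
        sumPairings η b (i + 1 + a + 1) (i + k + 1) := by
  rw [sumPairings_eq_sum_Ioo η b (by omega)]
  refine (Finset.sum_nbij (fun a => i + 1 + a) ?_ ?_ ?_ fun _ _ => rfl).symm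
  · intro a ha
    simp only [Finset.mem_range, Finset.mem_Ioo] at ha ⊢
    omega
  · intro a _ a' _ h
    simpa using h
  · intro m hm
    simp only [Finset.coe_Ioo, Set.mem_Ioo] at hm
    exact ⟨m - (i + 1), by simp; omega, by simp only; omega⟩

theorem sumPairings_congr (η : B → B) {b b' : ℕ → B} (i j : ℕ)
    (hb : ∀ l, i ≤ l → l < j → b l = b' l) : sumPairings η b i j = sumPairings η b' i j :=
  Finset.sum_congr rfl fun _ _ => evalPairing_congr η i j (fun _ _ _ => rfl) hb

/-- Translation invariance follows from the recursion alone, by strong induction, with no need to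
shift pairings. -/
theorem sumPairings_const_add (η : B →+ B) (g : B) (i k : ℕ) :
    sumPairings η (fun _ => g) i (i + k) = sumPairings η (fun _ => g) 0 k := by
  induction k using Nat.strong_induction_on generalizing i with
  | _ k ih =>
    rcases k with _ | k
    · simp only [add_zero, sumPairings_self]
    · have h := sumPairings_succ η (fun _ => g) 0 k
      rw [zero_add] at h
      rw [← add_assoc, sumPairings_succ, h]
      refine Finset.sum_congr rfl fun a ha => ?_
      rw [Finset.mem_range] at ha
      rw [ih a (by omega), show i + k + 1 = i + 1 + a + 1 + (k - 1 - a) by omega,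
        ih (k - 1 - a) (by omega), zero_add, ih a (by omega),
        show k + 1 = 1 + a + 1 + (k - 1 - a) by omega, ih (k - 1 - a) (by omega)]

/-- The first block uses two letters and the other `k` are split between its inside and its outside;
the antidiagonal form matches a Cauchy product of series. -/
theorem sumPairings_const_add_two (η : B →+ B) (g : B) (k : ℕ) :
    sumPairings η (fun _ => g) 0 (k + 2) = ∑ x ∈ Finset.HasAntidiagonal.antidiagonal k,
      η (g * sumPairings η (fun _ => g) 0 x.1) * g * sumPairings η (fun _ => g) 0 x.2 := by
  have h := sumPairings_succ η (fun _ => g) 0 (k + 1)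
  rw [Finset.Nat.sum_antidiagonal_eq_sum_range_succ
    (fun a c => η (g * sumPairings η (fun _ => g) 0 a) * g * sumPairings η (fun _ => g) 0 c)]
  rw [zero_add] at h
  rw [h]
  refine Finset.sum_congr rfl fun a ha => ?_
  rw [Finset.mem_range] at ha
  rw [zero_add, sumPairings_const_add, show k + 1 + 1 = 1 + a + 1 + (k - a) by omega,
    sumPairings_const_add]

theorem sumPairings_one (η : B →+ B) (b : ℕ → B) (i : ℕ) : sumPairings η b i (i + 1) = 0 := by
  simpa using sumPairings_succ η b i 0

/-- The last letter closes an outermost block, so its coefficient is the rightmost factor of every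
term. This supplies the coefficient missing after the last letter of a word. -/
theorem sumPairings_mul_right (η : B →+ B) {b b' : ℕ → B} {g : B} (i k : ℕ)
    (hb : ∀ l, l < i + k → b l = b' l) (hg : b' (i + k) = b (i + k) * g) :
    sumPairings η b i (i + k + 1) * g = sumPairings η b' i (i + k + 1) := by
  induction k using Nat.strong_induction_on generalizing i with
  | _ k ih =>
    rw [sumPairings_succ, sumPairings_succ, Finset.sum_mul]
    refine Finset.sum_congr rfl fun a ha => ?_
    rw [Finset.mem_range] at ha
    rw [sumPairings_congr η (b := b) (b' := b') (i + 1) (i + 1 + a)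
      (fun l _ _ => hb l (by omega)), hb i (by omega)]
    by_cases hak : a + 1 = k
    · rw [show i + 1 + a + 1 = i + k + 1 by omega, sumPairings_self, sumPairings_self,
        mul_one, mul_one, show i + 1 + a = i + k by omega, hg, mul_assoc]
    · rw [hb (i + 1 + a) (by omega), mul_assoc,
        show i + k + 1 = i + 1 + a + 1 + (k - 2 - a) + 1 by omega,
        ih (k - 2 - a) (by omega) (i + 1 + a + 1) (fun l hl => hb l (by omega))
          (by rw [show i + 1 + a + 1 + (k - 2 - a) = i + k by omega, hg])]

/-- The default value `1` at index `n` stands for the absent coefficient after the last letter. -/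
theorem sum_covPairing_eq_sumPairings (η : B → B) {n : ℕ} (b : Fin n → B) :
    ∑ π ∈ NC₂ (n + 1), covPairing η π b =
      sumPairings η (fun i => if h : i < n then b ⟨i, h⟩ else 1) 0 (n + 1) := by
  refine Finset.sum_bij' (fun π _ i => if h : i < n + 1 then (π ⟨i, h⟩ : ℕ) else i)
    (fun p _ i => if h : p i < n + 1 then ⟨p i, h⟩ else i) ?_ ?_ ?_ ?_ fun _ _ => rfl
  · intro π hπ
    simp only [NC₂, Finset.mem_filter, Finset.mem_univ, true_and] at hπ
    obtain ⟨h1, h2, h3⟩ := hπ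
    rw [mem_intervalPairingsFinset]
    refine ⟨fun l hl => dif_neg (by omega), fun l _ hl => ?_, fun k l hkl hl => ?_⟩
    · simp only [dif_pos hl]
      refine ⟨Nat.zero_le _, (π _).2, fun h => h1 ⟨l, hl⟩ (Fin.ext h), ?_⟩
      rw [dif_pos (π _).2, Fin.eta, h2]
    · by_cases hk : k < n + 1
      · simp only [dif_pos hk] at hl ⊢
        have hl' : l < n + 1 := hl.trans (π _).2
        simp only [dif_pos hl']
        exact not_lt.mp (h3 ⟨k, hk⟩ ⟨l, hl'⟩ hkl hl)
      · simp only [dif_neg hk] at hl; omega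
  · intro p hp
    rw [mem_intervalPairingsFinset] at hp
    obtain ⟨-, h2, h3⟩ := hp
    have hlt : ∀ i : Fin (n + 1), p i < n + 1 := fun i => (h2 i (Nat.zero_le _) i.2).2.1
    simp only [NC₂, Finset.mem_filter, Finset.mem_univ, true_and, hlt, dif_pos]
    refine ⟨fun i h => (h2 i (Nat.zero_le _) i.2).2.2.1 (congrArg Fin.val h), fun i => ?_,
      fun i j hij hj => ?_⟩
    · exact Fin.ext (h2 i (Nat.zero_le _) i.2).2.2.2
    · exact not_lt.mpr (h3 i j hij hj)
  · intro π _
    funext i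
    simp only [i.2, (π i).2, dif_pos, Fin.eta]
  · intro p hp
    rw [mem_intervalPairingsFinset] at hp
    funext i
    by_cases hi : i < n + 1
    · simp [hi, (hp.2.1 i (Nat.zero_le _) hi).2.1]
    · simp [hi, hp.1 i (by omega)]

end NonCrossing

/-! ### The Dyson equation for the operator-valued Cauchy transform. -/

section Dyson

variable {A : Type*} {B : Type*} [CStarAlgebra A] [PartialOrder A] [StarOrderedRing A]
  [CStarAlgebra B] [PartialOrder B] [StarOrderedRing B]

namespace OpValuedProbSpace

variable (P : OpValuedProbSpace A B)

theorem condExp_mul_incl (x : A) (b : B) : P.condExp (x * P.incl b) = P.condExp x * b := by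
  simpa using P.condExp_bimodule 1 x b

theorem condExp_incl_mul (x : A) (b : B) : P.condExp (P.incl b * x) = b * P.condExp x := by
  simpa using P.condExp_bimodule b x 1

/-- The conditional expectation as a continuous linear map. -/
noncomputable def condExpL : A →L[ℂ] B := ⟨(P.condExp : A →ₗ[ℂ] B), map_continuous P.condExp⟩

theorem condExpL_apply (x : A) : P.condExpL x = P.condExp x := rfl

theorem smul_one_le_imaginaryPart_incl_sub {b : B} {x : A} {δ : ℝ} (hb : δ • (1 : B) ≤ ℑ b)
    (hx : IsSelfAdjoint x) : δ • (1 : A) ≤ ℑ (P.incl b - x) := by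
  have h1 : (P.incl (ℑ b : B) : A) = ℑ (P.incl b) :=
    coe_imaginaryPart_map (P.incl : B →ₗ[ℂ] A) (map_star P.incl) b
  have h2 : P.incl (δ • (1 : B)) ≤ P.incl (ℑ b : B) := OrderHomClass.mono P.incl hb
  have h3 : P.incl (δ • (1 : B)) = δ • (1 : A) := by
    rw [← Complex.coe_smul, map_smul, map_one, Complex.coe_smul]
  rw [map_sub, AddSubgroupClass.coe_sub, coe_imaginaryPart_of_isSelfAdjoint hx, sub_zero, ← h1,
    ← h3]
  exact h2

theorem condExp_mem_lowerHalfPlane {a : A} (ha : a ∈ lowerHalfPlane A) :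
    P.condExp a ∈ lowerHalfPlane B := by
  obtain ⟨δ, hδ, h⟩ := ha
  refine ⟨δ, hδ, ?_⟩
  have h1 : (P.condExp (ℑ a : A) : B) = ℑ (P.condExp a) :=
    coe_imaginaryPart_map (P.condExp : A →ₗ[ℂ] B) (map_star P.condExp) a
  have h2 : P.condExp (δ • (1 : A)) = δ • (1 : B) := by
    rw [← Complex.coe_smul, map_smul, P.condExp_one, Complex.coe_smul]
  have h3 := OrderHomClass.mono P.condExp h
  rwa [h2, map_neg, h1] at h3

variable {P} {η : B →CP B} {x : A}

theorem IsCenteredSemicircular.condExp_pow (hx : P.IsCenteredSemicircular η x) (g : B) (k : ℕ) :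
    P.condExp ((x * P.incl g) ^ k) = sumPairings η (fun _ => g) 0 k := by
  rcases k with _ | n
  · rw [pow_zero, P.condExp_one, sumPairings_self]
  · have h1 : (x * P.incl g) ^ (n + 1) = P.word x (fun _ : Fin n => g) * P.incl g := by
      rw [word, List.ofFn_const, List.prod_replicate, pow_succ, mul_assoc]
    rw [h1, P.condExp_mul_incl, hx.2, sum_covPairing_eq_sumPairings]
    have h2 := sumPairings_mul_right (η : B →+ B) (b := fun i => if i < n then g else 1)
      (b' := fun _ => g) (g := g) 0 n (fun l hl => by rw [if_pos (by omega)])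
      (by rw [if_neg (by omega), one_mul])
    rw [zero_add] at h2
    simpa using h2

/-- The Neumann series `r = g ∑ (xg)^k` gives `E[r] = gC`, where `C` is the sum of the moments `c
k`. Summing their recursion yields `C = 1 + η(gC) g C`, which is the claim because `bg = 1`. -/
theorem IsCenteredSemicircular.dyson_of_norm_lt (hx : P.IsCenteredSemicircular η x) {b g : B}
    {r : A} (hbg : b * g = 1) (hg : ‖x * P.incl g‖ < 1) (hr : r * (P.incl b - x) = 1) :
    (b - η (P.condExp r)) * P.condExp r = 1 := by
  set T : A := x * P.incl g with hT
  set c : ℕ → B := fun k => sumPairings η (fun _ => g) 0 k with hc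
  have hsT : Summable fun k : ℕ => ‖T ^ k‖ := summable_norm_geometric_of_norm_lt_one hg
  have hcT : ∀ k, P.condExpL (T ^ k) = c k := fun k => hx.condExp_pow g k
  have hC : P.condExpL (∑' k, T ^ k) = ∑' k, c k := by
    rw [P.condExpL.map_tsum hsT.of_norm]
    exact tsum_congr hcT
  have hcs : Summable fun k => ‖c k‖ :=
    Summable.of_nonneg_of_le (fun _ => norm_nonneg _)
      (fun k => by rw [← hcT k]; exact P.condExpL.le_opNorm _) (hsT.mul_left ‖P.condExpL‖)
  set C : B := ∑' k, c k with hCdef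
  have hr' : r = P.incl g * ∑' k, T ^ k := by
    have h1 : (P.incl b - x) * (P.incl g * ∑' k, T ^ k) = 1 := by
      rw [← mul_assoc, sub_mul, ← map_mul, hbg, map_one]
      exact mul_neg_geom_series T hg
    calc r = r * ((P.incl b - x) * (P.incl g * ∑' k, T ^ k)) := by rw [h1, mul_one]
      _ = _ := by rw [← mul_assoc, hr, one_mul]
  have hrC : P.condExp r = g * C := by
    rw [hr', P.condExp_incl_mul, ← P.condExpL_apply, hC]
  set ηL : B →L[ℂ] B := ⟨(η : B →ₗ[ℂ] B), map_continuous η⟩ with hηL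
  have hηC : η (g * C) * g = ∑' k, η (g * c k) * g := by
    have h1 : HasSum (fun k => ηL (g * c k)) (ηL (g * C)) :=
      ηL.hasSum (hcs.of_norm.hasSum.mul_left g)
    exact (h1.mul_right g).tsum_eq.symm
  have hηs : Summable fun k => ‖η (g * c k) * g‖ := by
    refine Summable.of_nonneg_of_le (fun _ => norm_nonneg _) (fun k => ?_)
      (hcs.mul_left (‖ηL‖ * ‖g‖ * ‖g‖))
    calc ‖η (g * c k) * g‖ ≤ ‖ηL (g * c k)‖ * ‖g‖ := norm_mul_le _ _
      _ ≤ (‖ηL‖ * (‖g‖ * ‖c k‖)) * ‖g‖ := by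
          gcongr
          exact (ηL.le_opNorm _).trans (by gcongr; exact norm_mul_le _ _)
      _ = _ := by ring
  -- Cauchy product of two absolutely convergent series, recognised term by term through the
  -- recursion.
  have hprod : η (g * C) * g * C = ∑' k, c (k + 2) := by
    rw [hηC, hCdef, tsum_mul_tsum_eq_tsum_sum_antidiagonal_of_summable_norm hηs hcs]
    exact tsum_congr fun k => (sumPairings_const_add_two (η : B →+ B) g k).symm
  have h01 : C = 1 + ∑' k, c (k + 2) := by
    rw [hCdef, ← hcs.of_norm.sum_add_tsum_nat_add 2, Finset.sum_range_succ, Finset.sum_range_one]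
    have h0 : c 0 = 1 := sumPairings_self η _ 0
    have h1 : c 1 = 0 := sumPairings_one (η : B →+ B) _ 0
    rw [h0, h1, add_zero]
  rw [hrC, sub_mul, ← mul_assoc, hbg, one_mul, ← mul_assoc, hprod, h01, add_sub_cancel_right]

/-- The operator-valued Cauchy transform of a centered semicircular element satisfies
`(b - η(G(b))) G(b) = 1`. -/
theorem IsCenteredSemicircular.dyson (hx : P.IsCenteredSemicircular η x) {b : B} {δ : ℝ}
    (hδ : 0 < δ) (hb : δ • (1 : B) ≤ ℑ b) :
    (b - η (P.condExp (Ring.inverse (P.incl b - x)))) *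
      P.condExp (Ring.inverse (P.incl b - x)) = 1 := by
  set ηL : B →L[ℂ] B := ⟨(η : B →ₗ[ℂ] B), map_continuous η⟩ with hηL
  -- The line `β z = b + iz` has `Im (β z) ≥ δ + Re z`, so the resolvent is analytic on `Re z > -δ`.
  -- The equation holds for `Re z > ‖x‖` by the Neumann series, and the identity theorem carries it
  -- to `z = 0`.
  set β : ℂ → B := fun z => b + (Complex.I * z) • (1 : B) with hβ
  set X : ℂ → A := fun z => P.incl b - x + (Complex.I * z) • (1 : A) with hX
  have hXβ : ∀ z, X z = P.incl (β z) - x := fun z => by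
    simp only [hX, hβ, map_add, map_smul, map_one]; abel
  set G : ℂ → B := fun z => P.condExpL (Ring.inverse (X z)) with hG
  set U : Set ℂ := {z | -δ < z.re} with hU
  have hUo : IsOpen U := isOpen_lt continuous_const Complex.continuous_re
  have him : ∀ z, (δ + z.re) • (1 : B) ≤ ℑ (β z) := fun z => by
    have h1 : (ℑ ((Complex.I * z) • (1 : B)) : B) = z.re • (1 : B) := by
      have h2 : (Complex.I * z) • (1 : B) =
          (Complex.I * (z.re : ℂ)) • (1 : B) + (-z.im) • (1 : B) := by
        rw [← Complex.coe_smul (-z.im) (1 : B), ← add_smul]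
        congr 1
        apply Complex.ext <;> simp
      rw [h2, map_add, AddSubgroup.coe_add, coe_imaginaryPart_I_smul_one,
        coe_imaginaryPart_of_isSelfAdjoint (by simp [IsSelfAdjoint]), add_zero]
    rw [hβ, map_add, AddSubgroup.coe_add, h1, add_smul]
    exact add_le_add_left hb _
  have hXu : ∀ z ∈ U, IsUnit (X z) := fun z hz => by
    rw [hXβ]
    have : 0 < δ + z.re := by have : -δ < z.re := hz; linarith
    exact isUnit_of_le_imaginaryPart this (P.smul_one_le_imaginaryPart_incl_sub (him z) hx.1)
  have hGd : DifferentiableOn ℂ G U := fun z hz => by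
    have h1 : DifferentiableAt ℂ X z := by fun_prop
    have h2 : DifferentiableAt ℂ (fun z => Ring.inverse (X z)) z :=
      (differentiableAt_inverse (hXu z hz)).comp z h1
    exact (P.condExpL.differentiableAt.comp z h2).differentiableWithinAt
  have hFd : DifferentiableOn ℂ (fun z => (β z - ηL (G z)) * G z - 1) U := by
    have h1 : DifferentiableOn ℂ β U := by fun_prop
    exact ((h1.sub (ηL.differentiable.comp_differentiableOn hGd)).mul hGd).sub_const 1
  have hFa : AnalyticOnNhd ℂ (fun z => (β z - ηL (G z)) * G z - 1) U := hFd.analyticOnNhd hUo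
  have hlarge : ∀ z : ℂ, ‖x‖ < z.re → (β z - ηL (G z)) * G z - 1 = 0 := fun z hz => by
    have hpos : 0 < δ + z.re := by linarith [norm_nonneg x]
    obtain ⟨u, hu⟩ := isUnit_of_le_imaginaryPart hpos (him z)
    have hug : β z * (↑u⁻¹ : B) = 1 := by rw [← hu]; exact u.mul_inv
    have hgn : ‖(↑u⁻¹ : B)‖ ≤ (δ + z.re)⁻¹ := norm_le_of_le_imaginaryPart hpos (him z) hug
    have hin : ‖P.incl (↑u⁻¹ : B)‖ ≤ ‖(↑u⁻¹ : B)‖ := NonUnitalStarAlgHom.norm_apply_le P.incl _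
    rw [sub_eq_zero]
    refine hx.dyson_of_norm_lt hug ?_ ?_
    · calc ‖x * P.incl (↑u⁻¹ : B)‖ ≤ ‖x‖ * (δ + z.re)⁻¹ := by
            refine (norm_mul_le _ _).trans ?_
            gcongr
            exact hin.trans hgn
        _ < 1 := by
            rw [← div_eq_mul_inv, div_lt_one hpos]; linarith
    · rw [← hXβ]
      exact Ring.inverse_mul_cancel _ (hXu z (show -δ < z.re by linarith [norm_nonneg x]))
  have hconn : IsPreconnected U := (convex_halfSpace_re_gt (-δ)).isPreconnected
  have hz0 : ((‖x‖ + 1 : ℝ) : ℂ) ∈ U := by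
    simp only [hU, Set.mem_ofPred_eq, Complex.ofReal_re]; linarith [norm_nonneg x]
  have hev : ∀ᶠ z in nhds ((‖x‖ + 1 : ℝ) : ℂ), (β z - ηL (G z)) * G z - 1 = 0 := by
    have ho : IsOpen {z : ℂ | ‖x‖ < z.re} := isOpen_lt continuous_const Complex.continuous_re
    filter_upwards [ho.mem_nhds (show ‖x‖ < ((‖x‖ + 1 : ℝ) : ℂ).re by simp)] with z hz
    exact hlarge z hz
  have h0 := hFa.eqOn_zero_of_preconnected_of_eventuallyEq_zero hconn hz0 hev
    (show (0 : ℂ) ∈ U by simpa [hU] using hδ)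
  have hX0 : X 0 = P.incl b - x := by simp [hX]
  have hβ0 : β 0 = b := by simp [hβ]
  simp only [hG, hX0, hβ0, Pi.zero_apply] at h0
  exact sub_eq_zero.mp h0

/-- Every solution `w` in the lower half-plane of `w⁻¹ = b - η(w)` is the value at `b` of the
operator-valued Cauchy transform. -/
theorem IsCenteredSemicircular.eq_condExp_inverse (hx : P.IsCenteredSemicircular η x) {b w : B}
    {δ : ℝ} (hδ : 0 < δ) (hb : δ • (1 : B) ≤ ℑ b) (hw : w ∈ lowerHalfPlane B)
    (h : w * (b - η w) = 1) : w = P.condExp (Ring.inverse (P.incl b - x)) := by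
  have him := P.smul_one_le_imaginaryPart_incl_sub hb hx.1
  exact dyson_unique η hδ hb hw (P.condExp_mem_lowerHalfPlane (inverse_mem_lowerHalfPlane hδ him
    (Ring.mul_inverse_cancel _ (isUnit_of_le_imaginaryPart hδ him)))) h (hx.dyson hδ hb)

end OpValuedProbSpace

end Dyson

/-! ### Inequalities for states. -/

section State

variable {A : Type*} [CStarAlgebra A]

theorem CStarState.norm_apply_le (f : CStarState A) (a : A) : ‖f a‖ ≤ ‖a‖ := by
  simpa [f.norm_eq_one] using f.toCLM.le_opNorm a

variable [PartialOrder A] [StarOrderedRing A]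

/-- The Cauchy-Schwarz inequality for a state. -/
theorem CStarState.norm_mul_le (f : CStarState A) (a c : A) :
    ‖f (a * c)‖ ≤ √(f (a * star a)).re * ‖c‖ := by
  set g := f.toPositive with hg
  have h := norm_inner_le_norm (𝕜 := ℂ) (g.toPreGNS (star a)) (g.toPreGNS c)
  rw [g.preGNS_inner_def, g.preGNS_norm_def, g.preGNS_norm_def] at h
  simp only [PositiveLinearMap.ofPreGNS_toPreGNS, star_star] at h
  refine h.trans (mul_le_mul_of_nonneg_left ?_ (Real.sqrt_nonneg _))
  refine Real.sqrt_le_iff.mpr ⟨norm_nonneg c, ?_⟩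
  calc (f (star c * c)).re ≤ ‖f (star c * c)‖ := Complex.re_le_norm _
    _ ≤ ‖star c * c‖ := f.norm_apply_le _
    _ = ‖c‖ ^ 2 := by rw [CStarRing.norm_star_mul_self, sq]

theorem CStarState.apply_imaginaryPart (f : CStarState A) (a : A) :
    f (ℑ a : A) = ((f a).im : ℂ) := by
  have h1 : f (star a) = star (f a) := map_star f.toPositive a
  have h2 : ∀ x : A, f ((2 : ℝ)⁻¹ • x) = (2 : ℝ)⁻¹ • f x := fun x => by
    rw [← Complex.coe_smul, map_smul, Complex.coe_smul]
  rw [imaginaryPart_apply_coe, map_smul, h2, map_sub, h1]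
  apply Complex.ext
  · simp; ring
  · simp

end State

/-! ### Expressing `θ` through the resolvent. -/

section Theta

variable {A : Type*} [CStarAlgebra A] [PartialOrder A] [StarOrderedRing A]

theorem im_cauchyTransform_I_mul (μ : Measure ℝ) [IsFiniteMeasure μ] {y : ℝ} (hy : 0 < y) :
    (cauchyTransform μ (Complex.I * (y : ℂ))).im = -(y * ∫ t, (y ^ 2 + t ^ 2)⁻¹ ∂μ) := by
  have him : ∀ t : ℝ, (1 / (Complex.I * (y : ℂ) - (t : ℂ))).im = -(y * (y ^ 2 + t ^ 2)⁻¹) := by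
    intro t
    have hd : Complex.normSq (Complex.I * (y : ℂ) - (t : ℂ)) = y ^ 2 + t ^ 2 := by
      simp [Complex.normSq_apply]; ring
    rw [one_div, Complex.inv_im, hd, div_eq_mul_inv]
    simp
  have hne : ∀ t : ℝ, Complex.I * (y : ℂ) - (t : ℂ) ≠ 0 := fun t h => by
    have := congrArg Complex.im h
    simp at this
    exact hy.ne' this
  have hint : Integrable (fun t : ℝ => 1 / (Complex.I * (y : ℂ) - (t : ℂ))) μ := by
    refine Integrable.of_bound (C := y⁻¹) ?_ (Filter.Eventually.of_forall fun t => ?_)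
    · refine Continuous.aestronglyMeasurable ?_
      exact continuous_const.div (by fun_prop) hne
    · rw [one_div, norm_inv]
      refine inv_anti₀ hy ?_
      calc y = |(Complex.I * (y : ℂ) - (t : ℂ)).im| := by simp [abs_of_pos hy]
        _ ≤ _ := Complex.abs_im_le_norm _
  have h := integral_im hint
  simp only [RCLike.im_to_complex, him] at h
  rw [cauchyTransform, ← h, integral_neg, integral_const_mul]

theorem integral_analyticDistribution (f : CStarState A) (s : A) (hs : IsSelfAdjoint s)
    (h : C(ℝ, ℝ)) : ∫ t, h t ∂(analyticDistribution f s hs) =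
      (f (cfcHom (R := ℝ) hs (h.restrict (spectrum ℝ s)))).re := by
  have hS : MeasurableSet (spectrum ℝ s) := (spectrum.isCompact s).measurableSet
  rw [analyticDistribution, (MeasurableEmbedding.subtype_coe hS).integral_map]
  exact integral_rieszMeasure_spectralFunctional f s hs (h.restrict (spectrum ℝ s))

/-- An inverse `q` of `y² + s²` computes `θ(y)`. -/
theorem theta_analyticDistribution (f : CStarState A) {s q : A} (hs : IsSelfAdjoint s) {y : ℝ}
    (hy : 0 < y) (hq : (y ^ 2 • (1 : A) + s ^ 2) * q = 1) :
    theta (analyticDistribution f s hs) y = y ^ 2 * (f q).re := by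
  have hne : ∀ t : ℝ, y ^ 2 + t ^ 2 ≠ 0 := fun t => by positivity
  set h : C(ℝ, ℝ) := ⟨fun t => (y ^ 2 + t ^ 2)⁻¹, by fun_prop (disch := exact hne _)⟩ with hh
  have h1 : h.restrict (spectrum ℝ s) * (y ^ 2 • (1 : C(spectrum ℝ s, ℝ)) +
      ((ContinuousMap.id ℝ).restrict (spectrum ℝ s)) ^ 2) = 1 := by
    ext t
    simpa [hh] using inv_mul_cancel₀ (hne t)
  have h2 := congrArg (cfcHom (R := ℝ) hs) h1
  rw [map_mul, map_add, map_smul, map_pow, cfcHom_id, map_one] at h2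
  have h3 : q = cfcHom (R := ℝ) hs (h.restrict (spectrum ℝ s)) := by
    calc q = cfcHom (R := ℝ) hs (h.restrict (spectrum ℝ s)) * (y ^ 2 • (1 : A) + s ^ 2) * q := by
          rw [h2, one_mul]
      _ = _ := by rw [mul_assoc, hq, mul_one]
  rw [theta, im_cauchyTransform_I_mul _ hy, h3, ← integral_analyticDistribution f s hs h]
  simp only [hh, ContinuousMap.coe_mk]
  ring

/-- The relations between `θ(y)` and the resolvent `r = (iy - s)⁻¹`. -/
theorem theta_resolvent (f : CStarState A) {s r : A} (hs : IsSelfAdjoint s) {y : ℝ}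
    (hy : 0 < y) (hr : ((Complex.I * (y : ℂ)) • (1 : A) - s) * r = 1)
    (hr' : r * ((Complex.I * (y : ℂ)) • (1 : A) - s) = 1) :
    theta (analyticDistribution f s hs) y = y ^ 2 * (f (r * star r)).re ∧
      theta (analyticDistribution f s hs) y = -y * (f r).im ∧
      0 < theta (analyticDistribution f s hs) y ∧
      theta (analyticDistribution f s hs) y ≤ 1 := by
  set X : A := (Complex.I * (y : ℂ)) • (1 : A) - s with hX
  have hXs : star X = -(Complex.I * (y : ℂ)) • (1 : A) - s := by
    rw [hX, star_sub, star_smul, star_one, hs.star_eq]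
    simp
  have hI : (Complex.I * (y : ℂ)) * -(Complex.I * (y : ℂ)) = ((y ^ 2 : ℝ) : ℂ) := by
    push_cast; linear_combination (-(y : ℂ) ^ 2) * Complex.I_mul_I
  have hXX : X * star X = y ^ 2 • (1 : A) + s ^ 2 := by
    rw [hXs, hX, sub_mul, mul_sub, mul_sub, smul_mul_smul_comm, hI, Complex.coe_smul, smul_mul_assoc,
      mul_smul_comm, neg_smul, mul_one, one_mul, mul_one]
    rw [sq s]
    abel
  have hXX' : star X * X = y ^ 2 • (1 : A) + s ^ 2 := by
    rw [hXs, hX, sub_mul, mul_sub, mul_sub, smul_mul_smul_comm, mul_comm (-_), hI, Complex.coe_smul,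
      smul_mul_assoc, mul_smul_comm, neg_smul, mul_one, one_mul, mul_one]
    rw [sq s]
    abel
  -- Since `X` is normal, `r r⋆` and `r⋆ r` both invert `y² + s²`. The first is the form that
  -- Cauchy-Schwarz produces, the second the one in `-Im r = y r⋆ r`.
  have hq : (y ^ 2 • (1 : A) + s ^ 2) * (r * star r) = 1 := by
    rw [← hXX', mul_assoc, ← mul_assoc X, hr, one_mul, ← star_mul, hr', star_one]
  have hq' : (y ^ 2 • (1 : A) + s ^ 2) * (star r * r) = 1 := by
    rw [← hXX, mul_assoc, ← mul_assoc (star X), ← star_mul, hr', star_one, one_mul, hr]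
  have him : (ℑ X : A) = y • 1 := by
    rw [hX, map_sub, AddSubgroupClass.coe_sub, coe_imaginaryPart_of_isSelfAdjoint hs, sub_zero,
      coe_imaginaryPart_I_smul_one]
  have h1 := theta_analyticDistribution f hs hy hq
  have h2 := theta_analyticDistribution f hs hy hq'
  have h3 : (f r).im = -(y * (f (star r * r)).re) := by
    have h4 := neg_coe_imaginaryPart_of_mul_eq_one hr
    rw [him, mul_smul_comm, smul_mul_assoc, mul_one] at h4
    have h5 := congrArg f h4
    rw [← Complex.coe_smul, map_smul, map_neg, f.apply_imaginaryPart] at h5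
    have h6 := congrArg Complex.re h5
    simp only [Complex.neg_re, Complex.ofReal_re, smul_eq_mul, Complex.re_ofReal_mul] at h6
    linarith
  have h4 : theta (analyticDistribution f s hs) y = -y * (f r).im := by rw [h2, h3]; ring
  refine ⟨h1, h4, ?_, ?_⟩
  -- Applying `f` to `1 ≤ ‖X‖² r⋆r` excludes `f(r⋆r) = 0`.
  · have h5 := f.map_nonneg (sub_nonneg.mpr (one_le_smul_star_mul_self hr))
    rw [map_sub, f.map_one, ← Complex.coe_smul, map_smul] at h5
    have h6 := (Complex.nonneg_iff.mp h5).1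
    simp only [Complex.sub_re, Complex.one_re, smul_eq_mul, Complex.re_ofReal_mul] at h6
    have h7 : 0 < (f (star r * r)).re := by
      by_contra h8
      nlinarith [sq_nonneg ‖X‖]
    rw [h2]; positivity
  · have h5 : ‖r‖ ≤ y⁻¹ := norm_le_of_le_imaginaryPart hy him.ge hr
    rw [h4]
    calc -y * (f r).im ≤ y * |(f r).im| := by nlinarith [neg_abs_le (f r).im]
      _ ≤ y * y⁻¹ := by
          gcongr
          exact (Complex.abs_im_le_norm _).trans ((f.norm_apply_le r).trans h5)
      _ = 1 := mul_inv_cancel₀ hy.ne'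

end Theta

/-! ### The error estimate and the main theorem. -/

namespace OpValuedProbSpace

variable {A : Type*} {B : Type*} [CStarAlgebra A] [PartialOrder A] [StarOrderedRing A]
  [CStarAlgebra B] [PartialOrder B] [StarOrderedRing B]

/-- The error estimate for an approximate solution of the equation `w⁻¹ = b - η(w)`. -/
theorem abs_theta_sub_le (P : OpValuedProbSpace A B) (φ : CStarState B) (η : B →CP B) (s : A)
    (hs : P.IsSemicircular η s) {y : ℝ} (hy : 0 < y) {w : B} (hw : w ∈ lowerHalfPlane B)
    (hΔ : ‖defect η ((Complex.I * (y : ℂ)) • (1 : B) - P.condExp s) w‖ < y) :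
    |theta (analyticDistribution (P.compState φ) s hs.1) y - (-y * (φ w).im)| ≤
      √(theta (analyticDistribution (P.compState φ) s hs.1) y) *
        (‖defect η ((Complex.I * (y : ℂ)) • (1 : B) - P.condExp s) w‖ /
          (y - ‖defect η ((Complex.I * (y : ℂ)) • (1 : B) - P.condExp s) w‖)) := by
  set f := P.compState φ with hf
  set b : B := (Complex.I * (y : ℂ)) • (1 : B) - P.condExp s with hb
  set D : B := defect η b w with hD
  set x : A := s - P.incl (P.condExp s) with hx
  have hEs : IsSelfAdjoint (P.condExp s) := by
    rw [IsSelfAdjoint, ← map_star, hs.1.star_eq]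
  have hδ : 0 < y - ‖D‖ := sub_pos.mpr hΔ
  have him : (y - ‖D‖) • (1 : B) ≤ ℑ (b - D) := by
    rw [hb, map_sub, map_sub, AddSubgroupClass.coe_sub, AddSubgroupClass.coe_sub,
      coe_imaginaryPart_of_isSelfAdjoint hEs, sub_zero, coe_imaginaryPart_I_smul_one, sub_smul]
    refine sub_le_sub_left ((le_norm_smul_one (ℑ D).2).trans ?_) _
    exact smul_le_smul_of_nonneg_right (norm_coe_imaginaryPart_le D) zero_le_one
  -- The defect is absorbed into the base point: `w` is an exact solution at `b - D`.
  have hwD : w * (b - D - η w) = 1 := by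
    have : b - D - η w = Ring.inverse w := by rw [hD, defect]; abel
    rw [this]
    exact Ring.mul_inverse_cancel _ (isUnit_of_mem_lowerHalfPlane hw)
  have hwE := hs.2.eq_condExp_inverse hδ him hw hwD
  have himX := P.smul_one_le_imaginaryPart_incl_sub him hs.2.1
  set X₁ : A := P.incl (b - D) - x with hX₁
  set X₀ : A := (Complex.I * (y : ℂ)) • (1 : A) - s with hX₀
  -- The term `E[s]` in `b` cancels against the centering of `s`, so only `D` separates the two
  -- resolvents.
  have hX : X₁ = X₀ - P.incl D := by
    simp only [hX₁, hX₀, hb, hx, map_sub, map_smul, map_one]; abel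
  have him₀ : y • (1 : A) ≤ ℑ X₀ := by
    rw [hX₀, map_sub, AddSubgroupClass.coe_sub, coe_imaginaryPart_of_isSelfAdjoint hs.1, sub_zero,
      coe_imaginaryPart_I_smul_one]
  have hu₀ := isUnit_of_le_imaginaryPart hy him₀
  have hu₁ := isUnit_of_le_imaginaryPart hδ himX
  set r₀ : A := Ring.inverse X₀ with hr₀
  set r₁ : A := Ring.inverse X₁ with hr₁
  obtain ⟨hθ, hθ', -, -⟩ := theta_resolvent f hs.1 hy (Ring.mul_inverse_cancel _ hu₀)
    (Ring.inverse_mul_cancel _ hu₀)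
  have hdiff : r₀ - r₁ = r₀ * -(P.incl D * r₁) := by
    calc r₀ - r₁ = r₀ * (X₁ * r₁) - r₀ * X₀ * r₁ := by
          rw [Ring.mul_inverse_cancel _ hu₁, Ring.inverse_mul_cancel _ hu₀, mul_one, one_mul]
      _ = _ := by rw [hX]; noncomm_ring
  have hfw : f r₁ = φ w := by rw [hf, compState_apply, ← hwE]
  have hnorm : ‖-(P.incl D * r₁)‖ ≤ ‖D‖ / (y - ‖D‖) := by
    rw [norm_neg, div_eq_mul_inv]
    refine (norm_mul_le _ _).trans ?_
    gcongr
    · exact NonUnitalStarAlgHom.norm_apply_le P.incl D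
    · exact norm_le_of_le_imaginaryPart hδ himX (Ring.mul_inverse_cancel _ hu₁)
  -- One factor `y` goes into `√θ`, so after cancelling it Cauchy-Schwarz for the product `r₀ · (-D
  -- r₁)` is all that remains.
  have hsqrt : √(theta (analyticDistribution f s hs.1) y) = y * √(f (r₀ * star r₀)).re := by
    rw [hθ, Real.sqrt_mul (sq_nonneg y), Real.sqrt_sq hy.le]
  rw [hsqrt, hθ', ← hfw, ← mul_sub, ← Complex.sub_im, ← map_sub, abs_mul, abs_neg, abs_of_pos hy,
    mul_assoc, hdiff]
  refine mul_le_mul_of_nonneg_left ?_ hy.le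
  calc |(f (r₀ * -(P.incl D * r₁))).im| ≤ ‖f (r₀ * -(P.incl D * r₁))‖ := Complex.abs_im_le_norm _
    _ ≤ √(f (r₀ * star r₀)).re * ‖-(P.incl D * r₁)‖ := f.norm_mul_le _ _
    _ ≤ _ := by gcongr

end OpValuedProbSpace

/-- Positivity makes the final estimate strict; the bound by `1` gives its second inequality. -/
theorem theta_analyticDistribution_pos_and_le_one {A : Type*} [CStarAlgebra A] [PartialOrder A]
    [StarOrderedRing A] (f : CStarState A) {s : A} (hs : IsSelfAdjoint s) {y : ℝ} (hy : 0 < y) :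
    0 < theta (analyticDistribution f s hs) y ∧ theta (analyticDistribution f s hs) y ≤ 1 := by
  have him : y • (1 : A) ≤ ℑ ((Complex.I * (y : ℂ)) • (1 : A) - s) := by
    rw [map_sub, AddSubgroupClass.coe_sub, coe_imaginaryPart_of_isSelfAdjoint hs, sub_zero,
      coe_imaginaryPart_I_smul_one]
  have hu := isUnit_of_le_imaginaryPart hy him
  exact (theta_resolvent f hs hy (Ring.mul_inverse_cancel _ hu)
    (Ring.inverse_mul_cancel _ hu)).2.2

end FreeProb
theorem mainTheorem2 {A : Type*} {B : Type*}
    [CStarAlgebra A] [PartialOrder A] [StarOrderedRing A]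
    [CStarAlgebra B] [PartialOrder B] [StarOrderedRing B]
    (P : FreeProb.OpValuedProbSpace A B) (φ : FreeProb.CStarState B) (η : B →CP B)
    (s : A) (hs : P.IsSemicircular η s) (y ε : ℝ) (hy : 0 < y) (hε : 0 < ε)
    (w : B) (hw : w ∈ FreeProb.lowerHalfPlane B)
    (hΔ : ‖FreeProb.defect η ((Complex.I * (y : ℂ)) • (1 : B) - P.condExp s) w‖
      < y * ε / (1 + ε)) :
    |FreeProb.theta (FreeProb.analyticDistribution (P.compState φ) s hs.1) y - (-y * (φ w).im)|
        < ε * √(FreeProb.theta (FreeProb.analyticDistribution (P.compState φ) s hs.1) y) ∧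
      ε * √(FreeProb.theta (FreeProb.analyticDistribution (P.compState φ) s hs.1) y) ≤ ε := by
  obtain ⟨hpos, hle⟩ := FreeProb.theta_analyticDistribution_pos_and_le_one (P.compState φ) hs.1 hy
  set d := ‖FreeProb.defect η ((Complex.I * (y : ℂ)) • (1 : B) - P.condExp s) w‖ with hd
  -- The threshold `yε / (1 + ε)` is the one for which `d / (y - d) < ε`; it also forces `d < y`.
  have h1 : d * (1 + ε) < y * ε := (lt_div_iff₀ (by positivity)).mp hΔ
  have hdy : d < y := by
    by_contra h
    nlinarith
  refine ⟨(P.abs_theta_sub_le φ η s hs hy hw hdy).trans_lt ?_, ?_⟩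
  · rw [mul_comm ε]
    refine mul_lt_mul_of_pos_left ?_ (Real.sqrt_pos.mpr hpos)
    rw [div_lt_iff₀ (sub_pos.mpr hdy)]
    linarith
  · exact mul_le_of_le_one_right hε.le (Real.sqrt_le_one.mpr hle)
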